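/- Let $\mathbb D$ be the open unit disc, $dA$ Lebesgue measure, $\varphi_a(z)=\frac{a-z}{1-\bar a z}$, and let $\mu$ be a positive Borel measure on $\mathbb D$ that is finite on compact subsets of $\mathbb D$. For a subarc $I\subseteq\partial\mathbb D$ of positive length let $|I|\in(0,1]$ be its normalized length ($|\partial\mathbb D|=1$) and $S(I)=\{z\in\mathbb D: 1-|I|<|z|<1,\ z/|z|\in I\}$. For $p>1$, $\alpha>1$ and $s,t>0$ let $F(p,p\alpha-2,t)$ be the space of holomorphic functions $f$ on $\mathbb D$ with $$\|f\|_{F(p,p\alpha-2,t)}:=|f(0)|+\sup_{a\in\mathbb D}\Big(\int_{\mathbb D}|f'(z)|^p(1-|z|^2)^{p\alpha-2}(1-|\varphi_a(z)|^2)^t\,dA(z)\Big)^{1/p}<\infty,$$ and let $\mathfrak T^\infty_{s,p}(\mu)$ be the space of holomorphic functions $f$ on $\mathbb D$ with $$\|f\|_{\mathfrak T^\infty_{s,p}(\mu)}:=\sup_{I\subseteq\partial\mathbb D}\Big(\frac1{|I|^s}\int_{S(I)}|f(z)|^p\,d\mu(z)\Big)^{1/p}<\infty$$ (a seminorm in general).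 For $\sigma>0$, $\mu$ is called a vanishing $\sigma$-Carleson measure if $\lim_{|I|\to0}\mu(S(I))/|I|^{\sigma}=0$. **Theorem.** Let $\alpha>1$, $0<t<s\le1$ and $p>1$. Then the identity map $f\mapsto f$ is a well-defined compact operator from $F(p,p\alpha-2,t)$ to $\mathfrak T^\infty_{s,p}(\mu)$ if and only if $\mu$ is a vanishing $[s+p(\alpha-1)]$-Carleson measure. -/

import Mathlib

open MeasureTheory Filter Topology
open scoped ENNReal

noncomputable section

namespace NearEndpoint

/-- The open unit disc of the complex plane. -/
abbrev disc : Set ℂ := Metric.ball (0 : ℂ) 1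

/-! ### The spaces `F(p, q, s)` -/

/-- The disc automorphism `φ_a(z) = (a - z) / (1 - conj a * z)`. -/
def mobius (a z : ℂ) : ℂ := (a - z) / (1 - (starRingEnd ℂ) a * z)

/-- The weight `(1 - |z|²)^q (1 - |φ_a(z)|²)^s`. -/
def fWeight (q s : ℝ) (a z : ℂ) : ℝ :=
  (1 - ‖z‖ ^ 2) ^ q * (1 - ‖mobius a z‖ ^ 2) ^ s

/-- The norm of `F(p, q, s)`, with value `∞` allowed:
`|f(0)| + sup_{a ∈ 𝔻} (∫_𝔻 |f'(z)|^p (1 - |z|²)^q (1 - |φ_a(z)|²)^s dA(z))^{1/p}`. -/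
def fENorm (p q s : ℝ) (f : ℂ → ℂ) : ℝ≥0∞ :=
  ‖f 0‖ₑ + ⨆ a : disc,
    (∫⁻ z in disc, ‖deriv f z‖ₑ ^ p * ENNReal.ofReal (fWeight q s a z)) ^ (1 / p)

lemma measurable_fWeight (q s : ℝ) (a : ℂ) : Measurable (fWeight q s a) := by
  unfold fWeight mobius
  fun_prop

lemma fENorm_zero {p q s : ℝ} (hp : 1 ≤ p) : fENorm p q s 0 = 0 := by
  have h0 : 0 < p := by linarith
  have hd : deriv (0 : ℂ → ℂ) = 0 := by
    funext z; exact deriv_const z (0 : ℂ)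
  simp [fENorm, hd, ENNReal.zero_rpow_of_pos h0, h0]

lemma fENorm_add_le {p q s : ℝ} (hp : 1 ≤ p) {f g : ℂ → ℂ}
    (hf : DifferentiableOn ℂ f disc) (hg : DifferentiableOn ℂ g disc) :
    fENorm p q s (f + g) ≤ fENorm p q s f + fENorm p q s g := by
  have h0 : 0 < p := by linarith
  have key : ∀ a : disc,
      (∫⁻ z in disc, ‖deriv (f + g) z‖ₑ ^ p * ENNReal.ofReal (fWeight q s a z)) ^ (1 / p) ≤
      (∫⁻ z in disc, ‖deriv f z‖ₑ ^ p * ENNReal.ofReal (fWeight q s a z)) ^ (1 / p) +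
      (∫⁻ z in disc, ‖deriv g z‖ₑ ^ p * ENNReal.ofReal (fWeight q s a z)) ^ (1 / p) := by
    intro a
    have hw : Measurable fun z => ENNReal.ofReal (fWeight q s a z) ^ (1 / p) :=
      ((measurable_fWeight q s a).ennreal_ofReal).pow_const _
    have hpow : ∀ (x : ℝ≥0∞) (z : ℂ), x ^ p * ENNReal.ofReal (fWeight q s a z) =
        (x * ENNReal.ofReal (fWeight q s a z) ^ (1 / p)) ^ p := by
      intro x z
      rw [ENNReal.mul_rpow_of_nonneg _ _ h0.le, ← ENNReal.rpow_mul, one_div,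
        inv_mul_cancel₀ h0.ne', ENNReal.rpow_one]
    simp only [hpow]
    have hm : ∀ h : ℂ → ℂ, AEMeasurable
        (fun z => ‖deriv h z‖ₑ * ENNReal.ofReal (fWeight q s a z) ^ (1 / p))
        (volume.restrict disc) := fun h =>
      ((measurable_deriv h).enorm.mul hw).aemeasurable
    refine le_trans ?_ (ENNReal.lintegral_Lp_add_le (hm f) (hm g) hp)
    refine ENNReal.rpow_le_rpow ?_ (by positivity)
    refine setLIntegral_mono' measurableSet_ball fun z hz => ?_
    refine ENNReal.rpow_le_rpow ?_ h0.le
    have hz' : disc ∈ 𝓝 z := Metric.isOpen_ball.mem_nhds hz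
    rw [deriv_add (hf.differentiableAt hz') (hg.differentiableAt hz'), Pi.add_apply, ← add_mul]
    gcongr
    exact enorm_add_le _ _
  unfold fENorm
  calc _ ≤ (‖f 0‖ₑ + ‖g 0‖ₑ) + ((⨆ a : disc, _) + (⨆ a : disc, _)) :=
        add_le_add (enorm_add_le _ _) (iSup_le fun a => (key a).trans
          (add_le_add (le_iSup (fun a : disc =>
            (∫⁻ z in disc, ‖deriv f z‖ₑ ^ p * ENNReal.ofReal (fWeight q s a z)) ^ (1 / p)) a)
            (le_iSup (fun a : disc =>
            (∫⁻ z in disc, ‖deriv g z‖ₑ ^ p * ENNReal.ofReal (fWeight q s a z)) ^ (1 / p)) a)))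
    _ = _ := by ring

lemma fENorm_smul {p q s : ℝ} (hp : 1 ≤ p) (c : ℂ) (f : ℂ → ℂ) :
    fENorm p q s (c • f) = ‖c‖ₑ * fENorm p q s f := by
  have h0 : 0 < p := by linarith
  have hd : ∀ z, deriv (c • f) z = c * deriv f z := fun z => by
    rw [deriv_const_smul_field, smul_eq_mul]
  have hc : ‖c‖ₑ ^ p ≠ ∞ := ENNReal.rpow_ne_top_of_nonneg h0.le enorm_ne_top
  unfold fENorm
  simp only [hd, enorm_mul, Pi.smul_apply, smul_eq_mul, ENNReal.mul_rpow_of_nonneg _ _ h0.le,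
    mul_assoc]
  rw [mul_add, ENNReal.mul_iSup]
  congr 2
  funext a
  rw [lintegral_const_mul' _ _ hc, ENNReal.mul_rpow_of_nonneg _ _ (by positivity),
    ← ENNReal.rpow_mul, mul_one_div_cancel h0.ne', ENNReal.rpow_one]

/-- The holomorphic functions on the disc with finite `F(p, q, s)` norm. A function on the disc is
represented by a function on `ℂ`; its values off the disc play no role in the norm. -/
def fSubmodule (p q s : ℝ) (hp : 1 ≤ p) : Submodule ℂ (ℂ → ℂ) where
  carrier := {f | DifferentiableOn ℂ f disc ∧ fENorm p q s f < ∞}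
  zero_mem' := ⟨differentiableOn_const 0, by rw [fENorm_zero hp]; simp⟩
  add_mem' := fun hf hg => ⟨hf.1.add hg.1,
    (fENorm_add_le hp hf.1 hg.1).trans_lt (ENNReal.add_lt_top.2 ⟨hf.2, hg.2⟩)⟩
  smul_mem' := fun c _ hf => ⟨hf.1.const_smul c, by
    rw [fENorm_smul hp]; exact ENNReal.mul_lt_top enorm_lt_top hf.2⟩

/-- The space `F(p, q, s)`. -/
def FSpace (p q s : ℝ) (hp : 1 ≤ p) : Type := fSubmodule p q s hp

instance (p q s : ℝ) (hp : 1 ≤ p) : AddCommGroup (FSpace p q s hp) :=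
  inferInstanceAs (AddCommGroup (fSubmodule p q s hp))

instance (p q s : ℝ) (hp : 1 ≤ p) : Module ℂ (FSpace p q s hp) :=
  inferInstanceAs (Module ℂ (fSubmodule p q s hp))

instance (p q s : ℝ) (hp : 1 ≤ p) : SeminormedAddCommGroup (FSpace p q s hp) :=
  AddGroupSeminorm.toSeminormedAddCommGroup
    { toFun := fun f : FSpace p q s hp => (fENorm p q s f.1).toReal
      map_zero' := by
        change (fENorm p q s 0).toReal = 0
        rw [fENorm_zero hp, ENNReal.toReal_zero]
      add_le' := fun f g => by
        change (fENorm p q s (f.1 + g.1)).toReal ≤ _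
        rw [← ENNReal.toReal_add f.2.2.ne g.2.2.ne]
        exact ENNReal.toReal_mono (ENNReal.add_lt_top.2 ⟨f.2.2, g.2.2⟩).ne
          (fENorm_add_le hp f.2.1 g.2.1)
      neg' := fun f => by
        change (fENorm p q s (-f.1)).toReal = _
        rw [← neg_one_smul ℂ f.1, fENorm_smul hp]
        simp }

/-! ### Arcs, Carleson tents and the tent spaces -/

/-- A nondegenerate closed subarc `{e^{iθ} : a ≤ θ ≤ b}` of the unit circle, `a < b ≤ a + 2π`.
Any other subarc of positive length lies in its closure, which has the same length, so that
suprema and limits over closed arcs are those over all arcs. -/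
structure Arc where
  /-- the initial angle -/
  a : ℝ
  /-- the final angle -/
  b : ℝ
  lt : a < b
  le : b ≤ a + 2 * Real.pi

/-- The set of points of an arc. -/
def Arc.points (I : Arc) : Set ℂ :=
  (fun θ : ℝ => Complex.exp (θ * Complex.I)) '' Set.Icc I.a I.b

/-- The normalized length `|I| ∈ (0, 1]` of an arc (the whole circle has length `1`). -/
def Arc.length (I : Arc) : ℝ := (I.b - I.a) / (2 * Real.pi)

lemma Arc.length_pos (I : Arc) : 0 < I.length :=
  div_pos (sub_pos.2 I.lt) (by positivity)

/-- The Carleson tent `S(I) = {z ∈ 𝔻 : 1 - |I| < |z| < 1, z / |z| ∈ I}`. -/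
def tent (I : Arc) : Set ℂ :=
  {z | 1 - I.length < ‖z‖ ∧ ‖z‖ < 1 ∧ z / (‖z‖ : ℂ) ∈ I.points}

lemma tent_subset (I : Arc) : tent I ⊆ disc := fun _ hz => mem_ball_zero_iff.2 hz.2.1

/-- The norm of the tent space, with value `∞` allowed:
`sup_I (|I|^{-s} ∫_{S(I)} |f|^p dμ)^{1/p}`. -/
def tENorm (p s : ℝ) (μ : Measure ℂ) (f : ℂ → ℂ) : ℝ≥0∞ :=
  ⨆ I : Arc, ((∫⁻ z in tent I, ‖f z‖ₑ ^ p ∂μ) / ENNReal.ofReal (I.length ^ s)) ^ (1 / p)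

lemma tENorm_zero {p s : ℝ} (hp : 1 ≤ p) (μ : Measure ℂ) : tENorm p s μ 0 = 0 := by
  have h0 : 0 < p := by linarith
  simp [tENorm, ENNReal.zero_rpow_of_pos h0, h0]

lemma tENorm_add_le {p s : ℝ} (hp : 1 ≤ p) {μ : Measure ℂ} {f g : ℂ → ℂ}
    (hf : DifferentiableOn ℂ f disc) (hg : DifferentiableOn ℂ g disc) :
    tENorm p s μ (f + g) ≤ tENorm p s μ f + tENorm p s μ g := by
  have h0 : 0 < p := by linarith
  have hm : ∀ (I : Arc) {h : ℂ → ℂ}, DifferentiableOn ℂ h disc →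
      AEMeasurable (fun z => ‖h z‖ₑ) (μ.restrict (tent I)) := fun I h hh =>
    ((hh.continuousOn.aemeasurable measurableSet_ball).mono_measure
      (Measure.restrict_mono (tent_subset I) le_rfl)).enorm
  refine iSup_le fun I => ?_
  refine le_trans ?_ (add_le_add
    (le_iSup (fun I : Arc =>
      ((∫⁻ z in tent I, ‖f z‖ₑ ^ p ∂μ) / ENNReal.ofReal (I.length ^ s)) ^ (1 / p)) I)
    (le_iSup (fun I : Arc =>
      ((∫⁻ z in tent I, ‖g z‖ₑ ^ p ∂μ) / ENNReal.ofReal (I.length ^ s)) ^ (1 / p)) I))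
  have h1 : 0 ≤ 1 / p := by positivity
  simp only [ENNReal.div_rpow_of_nonneg _ _ h1]
  rw [← ENNReal.add_div]
  gcongr
  refine le_trans ?_ (ENNReal.lintegral_Lp_add_le (hm I hf) (hm I hg) hp)
  refine ENNReal.rpow_le_rpow (lintegral_mono fun z => ?_) h1
  exact ENNReal.rpow_le_rpow (enorm_add_le _ _) h0.le

lemma tENorm_smul {p s : ℝ} (hp : 1 ≤ p) (μ : Measure ℂ) (c : ℂ) (f : ℂ → ℂ) :
    tENorm p s μ (c • f) = ‖c‖ₑ * tENorm p s μ f := by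
  have h0 : 0 < p := by linarith
  have hc : ‖c‖ₑ ^ p ≠ ∞ := ENNReal.rpow_ne_top_of_nonneg h0.le enorm_ne_top
  unfold tENorm
  simp only [enorm_mul, Pi.smul_apply, smul_eq_mul, ENNReal.mul_rpow_of_nonneg _ _ h0.le]
  rw [ENNReal.mul_iSup]
  congr 1
  funext I
  rw [lintegral_const_mul' _ _ hc, mul_div_assoc, ENNReal.mul_rpow_of_nonneg _ _ (by positivity),
    ← ENNReal.rpow_mul, mul_one_div_cancel h0.ne', ENNReal.rpow_one]

/-- The holomorphic functions on the disc with finite tent space norm (values off the disc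
play no role, as above). -/
def tSubmodule (p s : ℝ) (μ : Measure ℂ) (hp : 1 ≤ p) : Submodule ℂ (ℂ → ℂ) where
  carrier := {f | DifferentiableOn ℂ f disc ∧ tENorm p s μ f < ∞}
  zero_mem' := ⟨differentiableOn_const 0, by rw [tENorm_zero hp]; simp⟩
  add_mem' := fun hf hg => ⟨hf.1.add hg.1,
    (tENorm_add_le hp hf.1 hg.1).trans_lt (ENNReal.add_lt_top.2 ⟨hf.2, hg.2⟩)⟩
  smul_mem' := fun c _ hf => ⟨hf.1.const_smul c, by
    rw [tENorm_smul hp]; exact ENNReal.mul_lt_top enorm_lt_top hf.2⟩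

/-- The tent space `𝔗^∞_{s,p}(μ)`. -/
def TSpace (p s : ℝ) (μ : Measure ℂ) (hp : 1 ≤ p) : Type := tSubmodule p s μ hp

instance (p s : ℝ) (μ : Measure ℂ) (hp : 1 ≤ p) : AddCommGroup (TSpace p s μ hp) :=
  inferInstanceAs (AddCommGroup (tSubmodule p s μ hp))

instance (p s : ℝ) (μ : Measure ℂ) (hp : 1 ≤ p) : Module ℂ (TSpace p s μ hp) :=
  inferInstanceAs (Module ℂ (tSubmodule p s μ hp))

instance (p s : ℝ) (μ : Measure ℂ) (hp : 1 ≤ p) : SeminormedAddCommGroup (TSpace p s μ hp) :=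
  AddGroupSeminorm.toSeminormedAddCommGroup
    { toFun := fun f : TSpace p s μ hp => (tENorm p s μ f.1).toReal
      map_zero' := by
        change (tENorm p s μ 0).toReal = 0
        rw [tENorm_zero hp, ENNReal.toReal_zero]
      add_le' := fun f g => by
        change (tENorm p s μ (f.1 + g.1)).toReal ≤ _
        rw [← ENNReal.toReal_add f.2.2.ne g.2.2.ne]
        exact ENNReal.toReal_mono (ENNReal.add_lt_top.2 ⟨f.2.2, g.2.2⟩).ne
          (tENorm_add_le hp f.2.1 g.2.1)
      neg' := fun f => by
        change (tENorm p s μ (-f.1)).toReal = _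
        rw [← neg_one_smul ℂ f.1, tENorm_smul hp]
        simp }

/-- The identity map `f ↦ f` from `F(p, q, t)` to the tent space, given that the former set of
functions is contained in the latter. -/
def idMap {p q t s : ℝ} {μ : Measure ℂ} {hp : 1 ≤ p}
    (h : fSubmodule p q t hp ≤ tSubmodule p s μ hp) :
    FSpace p q t hp →ₗ[ℂ] TSpace p s μ hp :=
  Submodule.inclusion h

/-- `id : F(p, q, t) → 𝔗^∞_{s,p}(μ)` is (well defined and) compact. -/
def IdIsCompact (p q t s : ℝ) (μ : Measure ℂ) (hp : 1 ≤ p) : Prop :=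
  ∃ h : fSubmodule p q t hp ≤ tSubmodule p s μ hp, IsCompactOperator (idMap h)

/-- Vanishing `σ`-Carleson measures: `μ(S(I)) / |I|^σ → 0` as `|I| → 0`. -/
def IsVanishingCarleson (σ : ℝ) (μ : Measure ℂ) : Prop :=
  Tendsto (fun I : Arc => μ (tent I) / ENNReal.ofReal (I.length ^ σ))
    (comap Arc.length (𝓝 0)) (𝓝 0)

end NearEndpoint

end

/-! Sufficiency rests on a quantitative Carleson embedding, `FBound.lintegral_tent_le`, whose bound
is linear in the Carleson constant. The submean value property gives |f'(u)| ≲ (1-|u|)^(-α), and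
integration along radii gives |f(z)| ≲ (1-|z|)^(1-α), since α > 1. For z in S(I), let v be the point
on the same radius with 1-|v| = |I|. Then |f(v)|^p ≲ |I|^(p(1-α)), and the Carleson bound
|I|^(s+p(α-1)) for μ(S(I)) turns this into |I|^s. The increment f(z) - f(v) uses the gap t < s.
Hölder's inequality along the radius with a power weight, followed by averaging over hyperbolic
discs, bounds |f(z)-f(v)|^p by |I|^(s-t) times the integral of |f'(w)|^p (1-|w|)^(p-2-(s-t)) over
points w near z. After integration in μ, Tonelli's theorem gives each w the factor
(1-|w|)^(s+p(α-1)), the order of the mass of a tent of size 1-|w|. The resulting weight is exactly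
(1-|w|)^(pα-2+t), and testing the norm of f at one point a shows that its integral near I is ≲ |I|^t
(`FBound.lintegral_near_le`). Compactness follows because norm balls are sequentially compact for
pointwise convergence (`FBound.exists_subseq`). For a bounded sequence tending to zero pointwise, a
compact part of the disc is handled by dominated convergence, and the remaining annulus has a small
Carleson constant because μ is vanishing (`exists_annulus_carleson_le`). Necessity comes from the
functions h^(N+1-α) / (1 - conj a z)^N with h = |I| and a = (1-h)ζ, where ζ is the midpoint of I.
They are bounded in F(p, pα-2, t) by the Forelli-Rudin estimate, tend to zero pointwise as |I| → 0,
and have size at least a constant times |I|^(1-α) on S(I). Compactness forces their tent norms to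
zero, and these norms dominate μ(S(I)) / |I|^(s+p(α-1)) (`measure_tent_div_le`). -/

namespace NearEndpoint

/-! ### Geometry of arcs and tents. -/

/-- The midpoint of an arc. -/
noncomputable def Arc.center (I : Arc) : ℂ := Complex.exp (((I.a + I.b) / 2 : ℝ) * Complex.I)

lemma Arc.norm_center (I : Arc) : ‖I.center‖ = 1 := Complex.norm_exp_ofReal_mul_I _

lemma Arc.length_le_one (I : Arc) : I.length ≤ 1 := by
  rw [Arc.length, div_le_one (by positivity)]
  linarith [I.le]

lemma norm_exp_sub_exp_le (x y : ℝ) :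
    ‖Complex.exp (x * Complex.I) - Complex.exp (y * Complex.I)‖ ≤ |x - y| := by
  have h := Real.norm_exp_I_mul_ofReal_sub_one_le (x := x - y)
  have e : Complex.exp (x * Complex.I) - Complex.exp (y * Complex.I) =
      Complex.exp (y * Complex.I) * (Complex.exp (Complex.I * (x - y : ℝ)) - 1) := by
    rw [mul_sub, ← Complex.exp_add]
    push_cast
    ring_nf
  rw [e, norm_mul, Complex.norm_exp_ofReal_mul_I, one_mul]
  exact h

lemma Arc.norm_sub_center_le (I : Arc) {ζ : ℂ} (h : ζ ∈ I.points) :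
    ‖ζ - I.center‖ ≤ Real.pi * I.length := by
  obtain ⟨θ, hθ, rfl⟩ := h
  refine (norm_exp_sub_exp_le _ _).trans ?_
  have e : Real.pi * I.length = (I.b - I.a) / 2 := by
    rw [Arc.length]; field_simp
  rw [e, abs_le]
  constructor <;> linarith [hθ.1, hθ.2]

lemma norm_div_norm_self {z : ℂ} (hz : z ≠ 0) : ‖z / (‖z‖ : ℂ)‖ = 1 := by
  rw [norm_div, Complex.norm_real, norm_norm, div_self (norm_ne_zero_iff.2 hz)]

lemma norm_mul_div_norm (z : ℂ) : (‖z‖ : ℂ) * (z / (‖z‖ : ℂ)) = z := by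
  rcases eq_or_ne z 0 with rfl | hz
  · simp
  · rw [mul_div_cancel₀ _ (by exact_mod_cast norm_ne_zero_iff.2 hz)]

lemma ne_zero_of_mem_tent {I : Arc} {z : ℂ} (hz : z ∈ tent I) : z ≠ 0 := by
  rintro rfl
  have := hz.1
  rw [norm_zero] at this
  linarith [I.length_le_one]

/-- Points on a radius through a point of an arc, at height at most the length of the arc. -/
lemma Arc.norm_smul_sub_center_le (I : Arc) {ζ : ℂ} (h : ζ ∈ I.points) {ρ : ℝ} (hρ : ρ ≤ 1) :
    ‖(ρ : ℂ) * ζ - I.center‖ ≤ (1 - ρ) + Real.pi * I.length := by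
  have hζ : ‖ζ‖ = 1 := by
    obtain ⟨θ, -, rfl⟩ := h
    exact Complex.norm_exp_ofReal_mul_I _
  have e : (ρ : ℂ) * ζ - I.center = -((1 - ρ : ℝ) : ℂ) * ζ + (ζ - I.center) := by
    push_cast; ring
  rw [e]
  refine (norm_add_le _ _).trans (add_le_add ?_ (I.norm_sub_center_le h))
  rw [norm_mul, hζ, mul_one, norm_neg, Complex.norm_real, Real.norm_eq_abs, abs_of_nonneg]
  linarith

lemma norm_sub_center_le_of_mem_tent {I : Arc} {z : ℂ} (hz : z ∈ tent I) :
    ‖z - I.center‖ ≤ 5 * I.length := by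
  have h := I.norm_smul_sub_center_le hz.2.2 hz.2.1.le
  rw [norm_mul_div_norm] at h
  nlinarith [Real.pi_lt_d2, hz.1, I.length_pos]

/-- Every arc length between `0` and `1` and every midpoint occur. -/
lemma exists_arc (θ : ℝ) {ℓ : ℝ} (h0 : 0 < ℓ) (h1 : ℓ ≤ 1) :
    ∃ J : Arc, J.length = ℓ ∧ J.a = θ - Real.pi * ℓ ∧ J.b = θ + Real.pi * ℓ := by
  have := Real.pi_pos
  refine ⟨⟨θ - Real.pi * ℓ, θ + Real.pi * ℓ, by nlinarith, by nlinarith⟩, ?_, rfl, rfl⟩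
  rw [Arc.length]
  field_simp
  ring

lemma exists_arc_length_one_tent : ∃ J : Arc, J.length = 1 ∧
    ∀ z : ℂ, z ≠ 0 → ‖z‖ < 1 → z ∈ tent J := by
  obtain ⟨J, hJ, ha, hb⟩ := exists_arc 0 one_pos le_rfl
  refine ⟨J, hJ, fun z hz h1 => ⟨by rw [hJ]; simpa using hz, h1, z.arg, ?_, ?_⟩⟩
  · rw [ha, hb]
    constructor <;> linarith [Complex.neg_pi_lt_arg z, Complex.arg_le_pi z]
  · have := Complex.norm_mul_exp_arg_mul_I z
    simp only
    rw [eq_div_iff (by exact_mod_cast norm_ne_zero_iff.2 hz), mul_comm, this]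

lemma norm_div_norm_sub_le {z w : ℂ} (hz : z ≠ 0) (hw : w ≠ 0) :
    ‖z / (‖z‖ : ℂ) - w / (‖w‖ : ℂ)‖ ≤ 2 * ‖z - w‖ / ‖w‖ := by
  have hw' : (‖w‖ : ℂ) ≠ 0 := by exact_mod_cast norm_ne_zero_iff.2 hw
  have e : z / (‖z‖ : ℂ) - w / (‖w‖ : ℂ) =
      (((‖w‖ - ‖z‖ : ℝ) : ℂ) * (z / (‖z‖ : ℂ)) + (z - w)) / (‖w‖ : ℂ) := by
    have := norm_mul_div_norm z
    rw [eq_div_iff hw']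
    push_cast
    rw [sub_mul, sub_mul, this, div_mul_cancel₀ _ hw']
    ring
  rw [e, norm_div, Complex.norm_real, norm_norm]
  gcongr
  refine (norm_add_le _ _).trans ?_
  rw [norm_mul, norm_div_norm_self hz, Complex.norm_real, Real.norm_eq_abs, mul_one]
  have := abs_norm_sub_norm_le w z
  rw [norm_sub_rev] at this
  linarith

/-- The points of the disc at distance at most `A (1 - |w|)` from `w` lie in a tent over an arc of
comparable length. -/
lemma exists_tent_of_near {w : ℂ} (hw : ‖w‖ < 1) {A : ℝ} (hA : 1 ≤ A) :
    ∃ J : Arc, J.length ≤ (2 * A + 2) * (1 - ‖w‖) ∧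
      ∀ z : ℂ, z ≠ 0 → ‖z‖ < 1 → ‖z - w‖ ≤ A * (1 - ‖w‖) → z ∈ tent J := by
  rcases le_or_gt 1 ((2 * A + 2) * (1 - ‖w‖)) with h | h
  · obtain ⟨J, hJ, hz⟩ := exists_arc_length_one_tent
    exact ⟨J, hJ ▸ h, fun z h0 h1 _ => hz z h0 h1⟩
  -- The length must exceed the height (A+1)(1-|w|) that z can reach. It must also cover the angle
  -- between z and w, which is at most π/2 times the chord 4A(1-|w|), that is, 2πA(1-|w|); the arc
  -- has half-angle π times its length.
  obtain ⟨J, hJ, ha, hb⟩ := exists_arc w.arg (ℓ := (2 * A + 2) * (1 - ‖w‖))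
    (by have : 0 < 1 - ‖w‖ := by linarith
        positivity) h.le
  refine ⟨J, hJ.le, fun z h0 h1 hzw => ⟨?_, h1, ?_⟩⟩
  · rw [hJ]
    have := norm_sub_norm_le w z
    rw [norm_sub_rev] at this
    nlinarith
  have hw2 : 1 / 2 < ‖w‖ := by nlinarith
  have hw0 : w ≠ 0 := norm_pos_iff.1 (by linarith)
  have hz1 := norm_div_norm_self h0
  have hw1 := norm_div_norm_self hw0
  set u := z / (‖z‖ : ℂ) with hu
  set v := w / (‖w‖ : ℂ) with hv
  have hu0 : u ≠ 0 := norm_pos_iff.1 (by linarith)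
  have hv0 : v ≠ 0 := norm_pos_iff.1 (by linarith)
  have hve : v = Complex.exp (w.arg * Complex.I) := by
    rw [hv, div_eq_iff (by exact_mod_cast norm_ne_zero_iff.2 hw0), mul_comm,
      Complex.norm_mul_exp_arg_mul_I]
  have hang := Complex.angle_le_mul_norm_sub hz1 hw1
  rw [Complex.angle_eq_abs_arg hu0 hv0] at hang
  have hd : ‖u - v‖ ≤ 4 * (A * (1 - ‖w‖)) := by
    refine (norm_div_norm_sub_le h0 hw0).trans ?_
    rw [div_le_iff₀ (by linarith)]
    nlinarith [norm_nonneg (z - w)]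
  have hθ : |(u / v).arg| ≤ Real.pi * ((2 * A + 2) * (1 - ‖w‖)) := by
    have := Real.pi_pos
    refine hang.trans ((mul_le_mul_of_nonneg_left hd (by positivity)).trans ?_)
    nlinarith [mul_pos this (sub_pos.2 hw)]
  rw [abs_le] at hθ
  refine ⟨w.arg + (u / v).arg, ⟨by rw [ha]; linarith [hθ.1], by rw [hb]; linarith [hθ.2]⟩, ?_⟩
  have h2 := Complex.norm_mul_exp_arg_mul_I (u / v)
  rw [norm_div, hz1, hw1, div_one, Complex.ofReal_one, one_mul] at h2
  simp only
  push_cast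
  rw [add_mul, Complex.exp_add, h2, ← hve, mul_div_cancel₀ _ hv0]

/-! ### The Möbius weight. -/

lemma norm_one_sub_conj_mul_pos {a z : ℂ} (ha : ‖a‖ < 1) (hz : ‖z‖ < 1) :
    0 < ‖1 - (starRingEnd ℂ) a * z‖ := by
  have h : ‖(starRingEnd ℂ) a * z‖ < 1 := by
    rw [norm_mul, RCLike.norm_conj]
    nlinarith [norm_nonneg a, norm_nonneg z]
  have := norm_sub_norm_le (1 : ℂ) ((starRingEnd ℂ) a * z)
  rw [norm_one] at this
  linarith

lemma one_sub_norm_mobius_sq {a z : ℂ} (ha : ‖a‖ < 1) (hz : ‖z‖ < 1) :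
    1 - ‖mobius a z‖ ^ 2 =
      (1 - ‖a‖ ^ 2) * (1 - ‖z‖ ^ 2) / ‖1 - (starRingEnd ℂ) a * z‖ ^ 2 := by
  have h := norm_one_sub_conj_mul_pos ha hz
  rw [mobius, norm_div, div_pow, eq_div_iff (by positivity), sub_mul, div_mul_cancel₀ _ (by positivity)]
  simp only [← Complex.normSq_eq_norm_sq, Complex.normSq_apply, Complex.sub_re, Complex.sub_im,
    Complex.mul_re, Complex.mul_im, Complex.conj_re, Complex.conj_im, Complex.one_re,
    Complex.one_im]
  ring

lemma one_sub_norm_mobius_sq_mem {a z : ℂ} (ha : ‖a‖ < 1) (hz : ‖z‖ < 1) :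
    0 ≤ 1 - ‖mobius a z‖ ^ 2 ∧ 1 - ‖mobius a z‖ ^ 2 ≤ 1 := by
  refine ⟨?_, by linarith [sq_nonneg ‖mobius a z‖]⟩
  rw [one_sub_norm_mobius_sq ha hz]
  have h1 : 0 ≤ 1 - ‖a‖ ^ 2 := by nlinarith [norm_nonneg a]
  have h2 : 0 ≤ 1 - ‖z‖ ^ 2 := by nlinarith [norm_nonneg z]
  positivity

/-- For `a = (1 - ℓ/2) ζ` with `|ζ| = 1`, near `ζ` at scale `ℓ` the weight `1 - |φ_a|²` dominates
`(1 - |w|) / ℓ`. -/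
lemma le_one_sub_norm_mobius_sq {ζ : ℂ} (hζ : ‖ζ‖ = 1) {ℓ : ℝ} (h0 : 0 < ℓ) (h1 : ℓ ≤ 1)
    {w : ℂ} (hw : ‖w‖ < 1) (hwζ : ‖w - ζ‖ ≤ 5 * ℓ) :
    (1 - ‖w‖) / ℓ / 98 ≤ 1 - ‖mobius (((1 - ℓ / 2 : ℝ) : ℂ) * ζ) w‖ ^ 2 := by
  set a : ℂ := ((1 - ℓ / 2 : ℝ) : ℂ) * ζ with ha
  have hna : ‖a‖ = 1 - ℓ / 2 := by
    rw [ha, norm_mul, hζ, mul_one, Complex.norm_real, Real.norm_eq_abs, abs_of_nonneg]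
    linarith
  have ha1 : ‖a‖ < 1 := by linarith
  rw [one_sub_norm_mobius_sq ha1 hw]
  have hpos := norm_one_sub_conj_mul_pos ha1 hw
  have hub : ‖1 - (starRingEnd ℂ) a * w‖ ≤ 7 * ℓ := by
    have e : 1 - (starRingEnd ℂ) a * w =
        ((1 - ‖a‖ ^ 2 : ℝ) : ℂ) + (starRingEnd ℂ) a * ((a - ζ) + (ζ - w)) := by
      have : (starRingEnd ℂ) a * a = ((‖a‖ ^ 2 : ℝ) : ℂ) := by
        rw [mul_comm, Complex.mul_conj, Complex.normSq_eq_norm_sq]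
      push_cast at this ⊢
      linear_combination -this
    have e2 : a - ζ = -((ℓ / 2 : ℝ) : ℂ) * ζ := by rw [ha]; push_cast; ring
    have hn2 : ‖a - ζ‖ = ℓ / 2 := by
      rw [e2, norm_mul, hζ, norm_neg, Complex.norm_real, Real.norm_eq_abs, abs_of_pos (by linarith),
        mul_one]
    rw [e]
    refine (norm_add_le _ _).trans ?_
    rw [Complex.norm_real, norm_mul ((starRingEnd ℂ) a), RCLike.norm_conj, Real.norm_eq_abs,
      abs_of_nonneg (by
      nlinarith [norm_nonneg a])]
    have h3 := norm_add_le (a - ζ) (ζ - w)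
    rw [hn2, norm_sub_rev ζ w] at h3
    have h4 : ‖a‖ * ‖a - ζ + (ζ - w)‖ ≤ 1 * (ℓ / 2 + 5 * ℓ) :=
      mul_le_mul ha1.le (by linarith) (norm_nonneg _) zero_le_one
    nlinarith
  rw [div_div, div_le_div_iff₀ (by positivity) (by positivity)]
  -- The constant is 98 = 2 · 49: a factor 2 from 1-|a|² ≥ ℓ/2 and 49 = 7² from the bound on the
  -- denominator.
  have h5 : ‖1 - (starRingEnd ℂ) a * w‖ ^ 2 ≤ 49 * ℓ ^ 2 := by nlinarith
  have h6 : ℓ / 2 ≤ 1 - ‖a‖ ^ 2 := by rw [hna]; nlinarith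
  have h7 : 1 - ‖w‖ ≤ 1 - ‖w‖ ^ 2 := by nlinarith [norm_nonneg w]
  have h8 : 0 < 1 - ‖w‖ := by linarith
  calc (1 - ‖w‖) * ‖1 - (starRingEnd ℂ) a * w‖ ^ 2 ≤ (1 - ‖w‖) * (49 * ℓ ^ 2) := by gcongr
    _ = ℓ / 2 * (1 - ‖w‖) * (ℓ * 98) := by ring
    _ ≤ _ := by gcongr; nlinarith

/-! ### Hölder's inequality, polar coordinates and submean values. -/

lemma lintegral_mul_rpow_le {X : Type*} [MeasurableSpace X] (μ : Measure X) {p : ℝ} (hp : 1 < p)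
    {f g : X → ℝ≥0∞} (hf : AEMeasurable f μ) (hg : AEMeasurable g μ) :
    (∫⁻ x, f x * g x ∂μ) ^ p ≤
      (∫⁻ x, f x ^ p ∂μ) * (∫⁻ x, g x ^ (p / (p - 1)) ∂μ) ^ (p - 1) := by
  have h0 : 0 < p := by linarith
  have hpq : p.HolderConjugate (p / (p - 1)) := Real.HolderConjugate.conjExponent hp
  have h := ENNReal.rpow_le_rpow (ENNReal.lintegral_mul_le_Lp_mul_Lq μ hpq hf hg) h0.le
  rw [ENNReal.mul_rpow_of_nonneg _ _ h0.le, ← ENNReal.rpow_mul, ← ENNReal.rpow_mul,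
    one_div_mul_cancel h0.ne', ENNReal.rpow_one] at h
  have e : 1 / (p / (p - 1)) * p = p - 1 := by field_simp
  rwa [e] at h

lemma lintegral_rpow_le {X : Type*} [MeasurableSpace X] (μ : Measure X) {p : ℝ} (hp : 1 < p)
    {f : X → ℝ≥0∞} (hf : AEMeasurable f μ) :
    (∫⁻ x, f x ∂μ) ^ p ≤ (∫⁻ x, f x ^ p ∂μ) * μ Set.univ ^ (p - 1) := by
  simpa using lintegral_mul_rpow_le μ hp hf (g := fun _ => 1) aemeasurable_const

/-- Integration in polar coordinates. -/
lemma lintegral_polar {F : ℂ → ℝ≥0∞} (hF : Measurable F) :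
    ∫⁻ z, F z = ∫⁻ r in Set.Ioi (0 : ℝ),
      ENNReal.ofReal r * ∫⁻ θ in Set.Ioo (-Real.pi) Real.pi, F (circleMap 0 r θ) := by
  rw [← Complex.lintegral_comp_polarCoord_symm, polarCoord_target, Measure.volume_eq_prod]
  have e : ∀ x : ℝ × ℝ, Complex.polarCoord.symm x = circleMap 0 x.1 x.2 := fun x => by
    rw [Complex.polarCoord_symm_apply, circleMap_zero, Complex.exp_mul_I]
    push_cast; ring_nf
  have hm : Measurable fun x : ℝ × ℝ => circleMap 0 x.1 x.2 := by
    unfold circleMap; fun_prop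
  simp only [e, smul_eq_mul]
  rw [setLIntegral_prod _ (by fun_prop)]
  refine lintegral_congr fun r => ?_
  dsimp only
  rw [lintegral_const_mul _ (by fun_prop)]

/-- The mean value property of h followed by Hölder's inequality on the circle; this avoids any
appeal to subharmonicity of |h|^p. -/
lemma enorm_rpow_mul_le_circle {h : ℂ → ℂ} {u : ℂ} {r p : ℝ} (hr : 0 < r) (hp : 1 < p)
    (hh : DifferentiableOn ℂ h (Metric.closedBall u r)) :
    ‖h u‖ₑ ^ p * ENNReal.ofReal (2 * Real.pi) ≤
      ∫⁻ θ in Set.Ioo (-Real.pi) Real.pi, ‖h (circleMap u r θ)‖ₑ ^ p := by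
  have hpi := Real.pi_pos
  have h0 : 0 < p := by linarith
  have hcont : Continuous fun θ => h (circleMap u r θ) :=
    hh.continuousOn.comp_continuous (continuous_circleMap u r)
      fun θ => circleMap_mem_closedBall u hr.le θ
  have hper : Function.Periodic (fun θ => h (circleMap u r θ)) (2 * Real.pi) := fun θ => by
    simp only [periodic_circleMap u r θ]
  have hav : Real.circleAverage h u r = h u := by
    apply DiffContOnCl.circleAverage
    rw [abs_of_pos hr]
    exact hh.diffContOnCl_ball subset_rfl
  have hint : (2 * Real.pi : ℝ) • h u = ∫ θ in Set.Ioo (-Real.pi) Real.pi, h (circleMap u r θ) := by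
    rw [← hav, Real.circleAverage_def, smul_smul, mul_inv_cancel₀ (by positivity), one_smul]
    have := hper.intervalIntegral_add_eq 0 (-Real.pi)
    rw [zero_add, show -Real.pi + 2 * Real.pi = Real.pi by ring] at this
    rw [this, intervalIntegral.integral_of_le (by linarith), integral_Ioc_eq_integral_Ioo]
  have h1 : ENNReal.ofReal (2 * Real.pi) * ‖h u‖ₑ ≤
      ∫⁻ θ in Set.Ioo (-Real.pi) Real.pi, ‖h (circleMap u r θ)‖ₑ := by
    have := enorm_integral_le_lintegral_enorm (μ := volume.restrict (Set.Ioo (-Real.pi) Real.pi))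
      fun θ => h (circleMap u r θ)
    rw [← hint, enorm_smul, Real.enorm_of_nonneg (by positivity)] at this
    exact this
  have h2 := (ENNReal.rpow_le_rpow h1 h0.le).trans
    (lintegral_rpow_le _ hp hcont.enorm.measurable.aemeasurable)
  rw [Measure.restrict_apply_univ, Real.volume_Ioo,
    show Real.pi - -Real.pi = 2 * Real.pi by ring, ENNReal.mul_rpow_of_nonneg _ _ h0.le] at h2
  have hc0 : ENNReal.ofReal (2 * Real.pi) ≠ 0 := by
    rw [Ne, ENNReal.ofReal_eq_zero]; push Not; positivity
  set c := ENNReal.ofReal (2 * Real.pi) with hc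
  have hct : c ≠ ∞ := ENNReal.ofReal_ne_top
  -- Hölder's inequality produces (2π)^(p-1) on the right against (2π)^p on the left; cancelling
  -- leaves a single factor 2π.
  have e : c ^ p = c ^ (p - 1) * c := by
    have := ENNReal.rpow_add (p - 1) 1 hc0 hct
    rwa [sub_add_cancel, ENNReal.rpow_one] at this
  have hk0 : c ^ (p - 1) ≠ 0 := (ENNReal.rpow_pos (pos_iff_ne_zero.2 hc0) hct).ne'
  have hkt : c ^ (p - 1) ≠ ∞ := ENNReal.rpow_ne_top_of_nonneg (by linarith) hct
  rw [e, mul_comm _ (c ^ (p - 1)), mul_assoc] at h2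
  rw [mul_comm]
  exact (ENNReal.mul_le_mul_iff_right hk0 hkt).1 h2

/-- The submean value property of `|h|^p` on discs. -/
lemma enorm_rpow_mul_le_ball {h : ℂ → ℂ} {u : ℂ} {R p : ℝ} (hR : 0 < R) (hp : 1 < p)
    (hm : Measurable h) (hh : DifferentiableOn ℂ h (Metric.ball u R)) :
    ‖h u‖ₑ ^ p * ENNReal.ofReal (R ^ 2) ≤ ∫⁻ z in Metric.ball u R, ‖h z‖ₑ ^ p := by
  have hpi := Real.pi_gt_three
  rw [← lintegral_indicator measurableSet_ball, ← lintegral_add_left_eq_self _ u, lintegral_polar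
    (by refine (Measurable.indicator ?_ measurableSet_ball).comp (measurable_const_add u)
        exact hm.enorm.pow_const p)]
  -- Integrating 2πr over (0, R) gives the area πR², of which only R² is kept.
  calc ‖h u‖ₑ ^ p * ENNReal.ofReal (R ^ 2)
      ≤ ∫⁻ r in Set.Ioo 0 R, ENNReal.ofReal r * (‖h u‖ₑ ^ p * ENNReal.ofReal (2 * Real.pi)) := by
        rw [lintegral_mul_const _ (by fun_prop), mul_left_comm]
        gcongr
        have hii : IntegrableOn (fun r : ℝ => r) (Set.Ioo 0 R) :=
          (continuous_id.integrableOn_Icc (a := 0) (b := R)).mono_set Set.Ioo_subset_Icc_self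
        rw [← ofReal_integral_eq_lintegral_ofReal hii
            ((ae_restrict_iff' measurableSet_Ioo).2 (Eventually.of_forall fun r hr => hr.1.le)),
          ← integral_Ioc_eq_integral_Ioo, ← intervalIntegral.integral_of_le hR.le, integral_id,
          ← ENNReal.ofReal_mul (by nlinarith [sq_nonneg R])]
        apply ENNReal.ofReal_le_ofReal
        nlinarith [sq_nonneg R]
    _ ≤ ∫⁻ r in Set.Ioo 0 R, ENNReal.ofReal r * ∫⁻ θ in Set.Ioo (-Real.pi) Real.pi,
          (Metric.ball u R).indicator (fun z => ‖h z‖ₑ ^ p) (u + circleMap 0 r θ) := by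
        refine setLIntegral_mono' measurableSet_Ioo fun r hr => ?_
        gcongr
        refine (enorm_rpow_mul_le_circle hr.1 hp
          (hh.mono (Metric.closedBall_subset_ball hr.2))).trans (le_of_eq ?_)
        refine lintegral_congr fun θ => ?_
        have e : u + circleMap 0 r θ = circleMap u r θ := by simp [circleMap]
        rw [e, Set.indicator_of_mem]
        exact Metric.closedBall_subset_ball hr.2 (circleMap_mem_closedBall u hr.1.le θ)
    _ ≤ _ := lintegral_mono_set Set.Ioo_subset_Ioi_self

/-- The constant K^|e| serves exponents of either sign, as is needed for pα - 2, which may be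
negative. -/
lemma rpow_le_of_comparable {x y K : ℝ} (hx : 0 < x) (hy : 0 < y) (hK : 1 ≤ K) (hxy : x ≤ K * y)
    (hyx : y ≤ K * x) (e : ℝ) : x ^ e ≤ K ^ |e| * y ^ e := by
  have hK0 : 0 < K := by linarith
  rcases le_total 0 e with he | he
  · rw [abs_of_nonneg he, ← Real.mul_rpow hK0.le hy.le]
    exact Real.rpow_le_rpow hx.le hxy he
  · rw [abs_of_nonpos he, Real.rpow_neg hK0.le, ← Real.inv_rpow hK0.le,
      ← Real.mul_rpow (by positivity) hy.le]
    refine Real.rpow_le_rpow_of_nonpos (by positivity) ?_ he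
    rw [inv_mul_le_iff₀ hK0]
    exact hyx

lemma enorm_rpow_eq_ofReal (z : ℂ) {p : ℝ} (hp : 0 ≤ p) :
    ‖z‖ₑ ^ p = ENNReal.ofReal (‖z‖ ^ p) := by
  rw [← ofReal_norm, ENNReal.ofReal_rpow_of_nonneg (norm_nonneg _) hp]

/-! ### Norm bounds in F(p, q, t) and the growth of f and f'. -/

/-- `f` is holomorphic on the disc, `|f(0)| ≤ M`, and all the integrals in the definition of the
norm of `F(p, q, t)` are at most `M ^ p`. -/
structure FBound (p q t M : ℝ) (f : ℂ → ℂ) : Prop where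
  diff : DifferentiableOn ℂ f disc
  zero_le : ‖f 0‖ ≤ M
  lintegral_le : ∀ a : disc, ∫⁻ z in disc, ‖deriv f z‖ₑ ^ p * ENNReal.ofReal (fWeight q t a z) ≤
    ENNReal.ofReal (M ^ p)

lemma FBound.nonneg {p q t M : ℝ} {f : ℂ → ℂ} (h : FBound p q t M f) : 0 ≤ M :=
  (norm_nonneg _).trans h.zero_le

lemma FBound.diff_deriv {p q t M : ℝ} {f : ℂ → ℂ} (h : FBound p q t M f) :
    DifferentiableOn ℂ (deriv f) disc := h.diff.deriv Metric.isOpen_ball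

lemma FBound.of_fENorm_le {p q t M : ℝ} (hp : 0 < p) (hM : 0 ≤ M) {f : ℂ → ℂ}
    (hf : DifferentiableOn ℂ f disc) (h : fENorm p q t f ≤ ENNReal.ofReal M) :
    FBound p q t M f := by
  refine ⟨hf, ?_, fun a => ?_⟩
  · rw [← ENNReal.ofReal_le_ofReal_iff hM, ofReal_norm]
    exact le_self_add.trans h
  · have h1 := (le_iSup (fun a : disc => (∫⁻ z in disc, ‖deriv f z‖ₑ ^ p *
      ENNReal.ofReal (fWeight q t a z)) ^ (1 / p)) a).trans (le_add_self.trans h)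
    have h2 := ENNReal.rpow_le_rpow h1 hp.le
    rwa [← ENNReal.rpow_mul, one_div_mul_cancel hp.ne', ENNReal.rpow_one,
      ENNReal.ofReal_rpow_of_nonneg hM hp.le] at h2

lemma FBound.fENorm_le {p q t M : ℝ} (hp : 0 < p) {f : ℂ → ℂ} (h : FBound p q t M f) :
    fENorm p q t f ≤ ENNReal.ofReal (2 * M) := by
  have hM := h.nonneg
  rw [two_mul, ENNReal.ofReal_add hM hM]
  refine add_le_add ?_ (iSup_le fun a => ?_)
  · rw [← ofReal_norm]
    exact ENNReal.ofReal_le_ofReal h.zero_le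
  · refine (ENNReal.rpow_le_rpow (h.lintegral_le a) (by positivity)).trans (le_of_eq ?_)
    rw [ENNReal.ofReal_rpow_of_nonneg (by positivity) (by positivity), ← Real.rpow_mul hM,
      mul_one_div_cancel hp.ne', Real.rpow_one]

/-- The integral in the norm is tested at the single point a = (1 - ℓ/2)ζ. There
`le_one_sub_norm_mobius_sq` bounds (1-|w|)^t by 98^t ℓ^t times the Möbius weight, and passing
between 1-|w| and 1-|w|² costs 2^|q|. -/
lemma FBound.lintegral_near_le {q t : ℝ} (ht : 0 < t) : ∃ C : ℝ, 0 < C ∧ ∀ {p M : ℝ} {f : ℂ → ℂ}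
    (_ : FBound p q t M f) {ζ : ℂ} (_ : ‖ζ‖ = 1) {ℓ : ℝ} (_ : 0 < ℓ) (_ : ℓ ≤ 1),
    ∫⁻ w in disc ∩ Metric.closedBall ζ (5 * ℓ), ‖deriv f w‖ₑ ^ p *
      ENNReal.ofReal ((1 - ‖w‖) ^ (q + t)) ≤ ENNReal.ofReal (C * ℓ ^ t * M ^ p) := by
  refine ⟨2 ^ |q| * 98 ^ t, by positivity, fun {p M f} h ζ hζ ℓ h0 h1 => ?_⟩
  have hM := h.nonneg
  set a : ℂ := ((1 - ℓ / 2 : ℝ) : ℂ) * ζ with ha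
  have hna : a ∈ disc := by
    rw [mem_ball_zero_iff, ha, norm_mul, hζ, mul_one, Complex.norm_real, Real.norm_eq_abs,
      abs_of_nonneg] <;> linarith
  set c := 2 ^ |q| * 98 ^ t * ℓ ^ t with hc
  have hc0 : 0 ≤ c := by positivity
  have key : ∀ w ∈ disc ∩ Metric.closedBall ζ (5 * ℓ),
      (1 - ‖w‖) ^ (q + t) ≤ c * fWeight q t a w := by
    rintro w ⟨hw, hwζ⟩
    rw [mem_ball_zero_iff] at hw
    rw [Metric.mem_closedBall, dist_eq_norm] at hwζ
    have hd : 0 < 1 - ‖w‖ := by linarith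
    have hw0 := norm_nonneg w
    have h2 := le_one_sub_norm_mobius_sq hζ h0 h1 hw hwζ
    have h3 : (1 - ‖w‖) ^ q ≤ 2 ^ |q| * (1 - ‖w‖ ^ 2) ^ q :=
      rpow_le_of_comparable hd (by nlinarith) one_le_two (by nlinarith) (by nlinarith) q
    have h4 := Real.rpow_le_rpow (by positivity) h2 ht.le
    rw [Real.div_rpow (by positivity) (by positivity), Real.div_rpow hd.le h0.le, div_div,
      div_le_iff₀ (by positivity)] at h4
    have h5 : 0 ≤ (1 - ‖w‖ ^ 2) ^ q := Real.rpow_nonneg (by nlinarith) _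
    rw [Real.rpow_add hd, fWeight]
    calc (1 - ‖w‖) ^ q * (1 - ‖w‖) ^ t ≤ (2 ^ |q| * (1 - ‖w‖ ^ 2) ^ q) *
          ((1 - ‖mobius a w‖ ^ 2) ^ t * (ℓ ^ t * 98 ^ t)) := by gcongr
      _ = _ := by rw [hc]; ring
  calc _ ≤ ∫⁻ w in disc ∩ Metric.closedBall ζ (5 * ℓ), ENNReal.ofReal c *
        (‖deriv f w‖ₑ ^ p * ENNReal.ofReal (fWeight q t a w)) := by
        refine setLIntegral_mono' (measurableSet_ball.inter measurableSet_closedBall) fun w hw => ?_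
        rw [mul_left_comm, ← ENNReal.ofReal_mul hc0]
        gcongr
        exact key w hw
    _ ≤ ENNReal.ofReal c * ENNReal.ofReal (M ^ p) := by
        rw [lintegral_const_mul' _ _ ENNReal.ofReal_ne_top]
        gcongr
        exact (lintegral_mono_set Set.inter_subset_left).trans (h.lintegral_le ⟨a, hna⟩)
    _ = _ := by rw [← ENNReal.ofReal_mul hc0]

lemma exists_norm_one_norm_sub (u : ℂ) (hu : ‖u‖ ≤ 1) : ∃ ζ : ℂ, ‖ζ‖ = 1 ∧ ‖u - ζ‖ = 1 - ‖u‖ := by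
  rcases eq_or_ne u 0 with rfl | h0
  · exact ⟨1, by simp⟩
  refine ⟨u / (‖u‖ : ℂ), norm_div_norm_self h0, ?_⟩
  have e : u - u / (‖u‖ : ℂ) = ((‖u‖ - 1 : ℝ) : ℂ) * (u / (‖u‖ : ℂ)) := by
    push_cast
    rw [sub_mul, norm_mul_div_norm, one_mul]
  rw [e, norm_mul, norm_div_norm_self h0, Complex.norm_real, Real.norm_eq_abs, abs_of_nonpos] <;>
    linarith

/-- Functions in `F(p, pα - 2, t)` are of Bloch type `α`. -/
lemma FBound.norm_deriv_le {p α t : ℝ} (hp : 1 < p) (ht : 0 < t) :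
    ∃ C : ℝ, 0 < C ∧ ∀ {M : ℝ} {f : ℂ → ℂ} (_ : FBound p (p * α - 2) t M f) {u : ℂ} (_ : ‖u‖ < 1),
    ‖deriv f u‖ ≤ C * M * (1 - ‖u‖) ^ (-α) := by
  obtain ⟨C, hC, hmain⟩ := FBound.lintegral_near_le (q := p * α - 2) ht
  have hp0 : 0 < p := by linarith
  set e := p * α - 2 + t with he
  refine ⟨(4 * (2 ^ |e| * C)) ^ (1 / p), by positivity, fun {M f} h u hu => ?_⟩
  have hM := h.nonneg
  -- The disc of radius ℓ/2 about u, with ℓ = 1-|u|, lies within 3ℓ/2 of the boundary point ζ, so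
  -- the local area bound applies at scale ℓ. On this disc 1-|w| is comparable to ℓ.
  obtain ⟨ζ, hζ, huζ⟩ := exists_norm_one_norm_sub u hu.le
  set ℓ := 1 - ‖u‖ with hℓ
  have hℓ0 : 0 < ℓ := by linarith
  have hℓ1 : ℓ ≤ 1 := by linarith [norm_nonneg u]
  have hball : ∀ w ∈ Metric.ball u (ℓ / 2), ℓ / 2 ≤ 1 - ‖w‖ ∧ 1 - ‖w‖ ≤ 3 / 2 * ℓ := by
    intro w hw
    rw [Metric.mem_ball, dist_eq_norm] at hw
    have := abs_le.1 (abs_norm_sub_norm_le w u)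
    constructor <;> linarith
  have hsub : Metric.ball u (ℓ / 2) ⊆ disc := fun w hw => by
    rw [mem_ball_zero_iff]; linarith [(hball w hw).1]
  have hsub2 : Metric.ball u (ℓ / 2) ⊆ disc ∩ Metric.closedBall ζ (5 * ℓ) := fun w hw => by
    refine ⟨hsub hw, ?_⟩
    rw [Metric.mem_ball, dist_eq_norm] at hw
    rw [Metric.mem_closedBall, dist_eq_norm]
    have := norm_sub_le_norm_sub_add_norm_sub w u ζ
    linarith
  have h1 := enorm_rpow_mul_le_ball (half_pos hℓ0) hp (measurable_deriv f) (h.diff_deriv.mono hsub)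
  have h2 : ∫⁻ z in Metric.ball u (ℓ / 2), ‖deriv f z‖ₑ ^ p ≤
      ENNReal.ofReal (2 ^ |e| * ℓ ^ (-e)) * ENNReal.ofReal (C * ℓ ^ t * M ^ p) := by
    calc _ ≤ ∫⁻ z in Metric.ball u (ℓ / 2), ENNReal.ofReal (2 ^ |e| * ℓ ^ (-e)) *
            (‖deriv f z‖ₑ ^ p * ENNReal.ofReal ((1 - ‖z‖) ^ e)) := by
          refine setLIntegral_mono' measurableSet_ball fun w hw => ?_
          rw [mul_left_comm, ← ENNReal.ofReal_mul (by positivity)]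
          refine le_mul_of_one_le_right' ?_
          rw [ENNReal.one_le_ofReal]
          have hb := hball w hw
          have := rpow_le_of_comparable hℓ0 (by linarith) one_le_two (y := 1 - ‖w‖) (by linarith)
            (by linarith) e
          calc (1 : ℝ) = ℓ ^ e * ℓ ^ (-e) := by rw [← Real.rpow_add hℓ0]; simp
            _ ≤ _ := by rw [mul_right_comm]; gcongr
      _ ≤ _ := by
          rw [lintegral_const_mul' _ _ ENNReal.ofReal_ne_top]
          gcongr
          exact (lintegral_mono_set hsub2).trans (hmain h hζ hℓ0 hℓ1)
  have h3 := h1.trans h2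
  rw [enorm_rpow_eq_ofReal _ hp0.le, ← ENNReal.ofReal_mul (by positivity),
    ← ENNReal.ofReal_mul (by positivity), ENNReal.ofReal_le_ofReal_iff (by positivity)] at h3
  have h4 : ‖deriv f u‖ ^ p ≤ 4 * (2 ^ |e| * C) * M ^ p * (ℓ ^ (-α)) ^ p := by
    have e1 : (ℓ ^ (-α)) ^ p * ℓ ^ 2 = ℓ ^ (-e) * ℓ ^ t := by
      rw [← Real.rpow_natCast, ← Real.rpow_mul hℓ0.le, ← Real.rpow_add hℓ0, ← Real.rpow_add hℓ0]
      congr 1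
      rw [he]; push_cast; ring
    have h5 : ‖deriv f u‖ ^ p * ℓ ^ 2 ≤ 4 * (2 ^ |e| * C) * M ^ p * (ℓ ^ (-α)) ^ p * ℓ ^ 2 := by
      rw [mul_assoc _ ((ℓ ^ (-α)) ^ p), e1]
      linarith
    exact le_of_mul_le_mul_right h5 (by positivity)
  rw [← Real.rpow_le_rpow_iff (norm_nonneg _) (by positivity) hp0]
  refine h4.trans (le_of_eq ?_)
  rw [Real.mul_rpow (by positivity) (by positivity), Real.mul_rpow (by positivity) hM,
    ← Real.rpow_mul (by positivity) (1 / p), one_div_mul_cancel hp0.ne', Real.rpow_one]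

lemma hasDerivAt_radius {f : ℂ → ℂ} (hf : DifferentiableOn ℂ f disc) {ζ : ℂ} {x : ℝ}
    (hx : ‖(x : ℂ) * ζ‖ < 1) :
    HasDerivAt (fun y : ℝ => f (y * ζ)) (deriv f (x * ζ) * ζ) x := by
  have h1 : HasDerivAt f (deriv f (x * ζ)) (x * ζ) :=
    (hf.differentiableAt (Metric.isOpen_ball.mem_nhds (mem_ball_zero_iff.2 hx))).hasDerivAt
  have h2 : HasDerivAt (fun y : ℂ => y * ζ) ζ (x : ℂ) := by
    simpa using (hasDerivAt_id (x : ℂ)).mul_const ζ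
  exact (HasDerivAt.comp (x : ℂ) h1 h2).comp_ofReal

/-- The derivative bound is integrated along the radius through z. As α > 1, the primitive of
(1-x)^(-α) is (1-x)^(1-α)/(α-1), which is unbounded and absorbs the contribution of f(0). -/
lemma FBound.norm_le {p α t : ℝ} (hp : 1 < p) (hα : 1 < α) (ht : 0 < t) :
    ∃ C : ℝ, 0 < C ∧ ∀ {M : ℝ} {f : ℂ → ℂ} (_ : FBound p (p * α - 2) t M f) {z : ℂ} (_ : ‖z‖ < 1),
    ‖f z‖ ≤ C * M * (1 - ‖z‖) ^ (1 - α) := by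
  obtain ⟨C, hC, hder⟩ := FBound.norm_deriv_le (α := α) hp ht
  have hα1 : 0 < α - 1 := by linarith
  refine ⟨1 + C / (α - 1), by positivity, fun {M f} h z hz => ?_⟩
  have hM := h.nonneg
  rcases eq_or_ne z 0 with rfl | hz0
  · have := h.zero_le
    have h2 : 0 ≤ C / (α - 1) * M := by positivity
    simp only [norm_zero, sub_zero, Real.one_rpow, mul_one]
    linarith
  set ζ := z / (‖z‖ : ℂ) with hζ
  have hζ1 : ‖ζ‖ = 1 := norm_div_norm_self hz0
  have hn : ∀ x ∈ Set.Icc 0 ‖z‖, ‖(x : ℂ) * ζ‖ = x := fun x hx => by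
    rw [norm_mul, hζ1, mul_one, Complex.norm_real, Real.norm_eq_abs, abs_of_nonneg hx.1]
  have hd : ∀ x ∈ Set.Icc 0 ‖z‖,
      HasDerivAt (fun y : ℝ => f (y * ζ)) (deriv f (x * ζ) * ζ) x := fun x hx =>
    hasDerivAt_radius h.diff (by rw [hn x hx]; linarith [hx.2])
  -- This majorant equals M at the origin and its derivative is the available bound for |f'|, as the
  -- comparison form of the mean value inequality requires.
  have hB : ∀ x ∈ Set.Icc 0 ‖z‖, HasDerivAt
      (fun y : ℝ => M + C * M / (α - 1) * ((1 - y) ^ (1 - α) - 1)) (C * M * (1 - x) ^ (-α)) x := by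
    intro x hx
    have h1 : HasDerivAt (fun y : ℝ => 1 - y) (-1) x := by
      simpa using (hasDerivAt_id x).const_sub 1
    have h2 := ((h1.rpow_const (p := 1 - α) (Or.inl (by linarith [hx.2]))).sub_const 1).const_mul
      (C * M / (α - 1))
    have e1 : C * M * (1 - x) ^ (-α) =
        C * M / (α - 1) * (-1 * (1 - α) * (1 - x) ^ (1 - α - 1)) := by
      rw [show 1 - α - 1 = -α by ring]
      field_simp
      ring
    rw [e1]
    exact h2.const_add M
  have key := image_norm_le_of_norm_deriv_right_le_deriv_boundary'
    (fun x hx => (hd x hx).continuousAt.continuousWithinAt)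
    (fun x hx => (hd x (Set.Ico_subset_Icc_self hx)).hasDerivWithinAt)
    (by simpa using h.zero_le)
    (fun x hx => (hB x hx).continuousAt.continuousWithinAt)
    (fun x hx => (hB x (Set.Ico_subset_Icc_self hx)).hasDerivWithinAt)
    (fun x hx => by
      have hx' := Set.Ico_subset_Icc_self hx
      have := hder h (u := x * ζ) (by rw [hn x hx']; linarith [hx.2])
      rw [hn x hx'] at this
      rwa [norm_mul, hζ1, mul_one])
    (Set.right_mem_Icc.2 (norm_nonneg z))
  rw [hζ, norm_mul_div_norm] at key
  refine key.trans ?_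
  have h1 : 1 ≤ (1 - ‖z‖) ^ (1 - α) :=
    Real.one_le_rpow_of_pos_of_le_one_of_nonpos (by linarith) (by linarith [norm_nonneg z])
      (by linarith)
  have h2 : 0 ≤ C * M / (α - 1) := by positivity
  have e : (1 + C / (α - 1)) * M * (1 - ‖z‖) ^ (1 - α) =
    M * (1 - ‖z‖) ^ (1 - α) + C * M / (α - 1) * (1 - ‖z‖) ^ (1 - α) := by ring
  rw [e]
  nlinarith

/-- The Lipschitz constant on a smaller disc depends only on M and r, which gives the equicontinuity
for the normal family argument. -/
lemma FBound.norm_sub_le {p α t : ℝ} (hp : 1 < p) (hα : 1 < α) (ht : 0 < t) :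
    ∃ C : ℝ, 0 < C ∧ ∀ {M : ℝ} {f : ℂ → ℂ} (_ : FBound p (p * α - 2) t M f) {r : ℝ} (_ : r < 1)
    {z w : ℂ} (_ : ‖z‖ ≤ r) (_ : ‖w‖ ≤ r), ‖f z - f w‖ ≤ C * M * (1 - r) ^ (-α) * ‖z - w‖ := by
  obtain ⟨C, hC, hder⟩ := FBound.norm_deriv_le (α := α) hp ht
  refine ⟨C, hC, fun {M f} h r hr z w hz hw => ?_⟩
  have hM := h.nonneg
  refine (convex_closedBall (0 : ℂ) r).norm_image_sub_le_of_norm_deriv_le (𝕜 := ℂ) (f := f)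
    (fun x hx => ?_) (fun x hx => ?_) (mem_closedBall_zero_iff.2 hw) (mem_closedBall_zero_iff.2 hz)
  · rw [mem_closedBall_zero_iff] at hx
    exact h.diff.differentiableAt (Metric.isOpen_ball.mem_nhds (mem_ball_zero_iff.2 (by linarith)))
  · rw [mem_closedBall_zero_iff] at hx
    refine (hder h (by linarith)).trans ?_
    have := Real.rpow_le_rpow_of_nonpos (z := -α) (by linarith : 0 < 1 - r)
      (by linarith : 1 - r ≤ 1 - ‖x‖) (by linarith)
    gcongr

/-! ### Increments along radii. -/

lemma lintegral_rpow_zero_le {c L : ℝ} (hc : -1 < c) (hL : 0 ≤ L) :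
    ∫⁻ x in Set.Ioc 0 L, ENNReal.ofReal (x ^ c) = ENNReal.ofReal (L ^ (c + 1) / (c + 1)) := by
  have hi : IntervalIntegrable (fun x : ℝ => x ^ c) volume 0 L :=
    intervalIntegral.intervalIntegrable_rpow' hc
  rw [← ofReal_integral_eq_lintegral_ofReal hi.1
      ((ae_restrict_iff' measurableSet_Ioc).2 (Eventually.of_forall fun x hx =>
        Real.rpow_nonneg hx.1.le _)),
    ← intervalIntegral.integral_of_le hL, integral_rpow (Or.inl hc),
    Real.zero_rpow (by linarith), sub_zero]

lemma lintegral_one_sub_rpow {c L : ℝ} (hc : -1 < c) (hL : 0 ≤ L) :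
    ∫⁻ x in Set.Ico (1 - L) 1, ENNReal.ofReal ((1 - x) ^ c) =
      ENNReal.ofReal (L ^ (c + 1) / (c + 1)) := by
  rw [← lintegral_rpow_zero_le hc hL, ← lintegral_indicator measurableSet_Ico,
    ← lintegral_indicator measurableSet_Ioc, ← lintegral_sub_left_eq_self _ (1 : ℝ)]
  refine lintegral_congr fun x => ?_
  have e : (1 - x ∈ Set.Ico (1 - L) 1) ↔ x ∈ Set.Ioc 0 L := by
    constructor <;> rintro ⟨h1, h2⟩ <;> constructor <;> linarith
  by_cases h : x ∈ Set.Ioc 0 L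
  · rw [Set.indicator_of_mem h, Set.indicator_of_mem (e.2 h), sub_sub_cancel]
  · rw [Set.indicator_of_notMem h, Set.indicator_of_notMem (mt e.1 h)]

lemma enorm_sub_le_lintegral_radius {f : ℂ → ℂ} (hf : DifferentiableOn ℂ f disc) {ζ : ℂ}
    (hζ : ‖ζ‖ = 1) {a b : ℝ} (ha : 0 ≤ a) (hab : a ≤ b) (hb : b < 1) :
    ‖f (b * ζ) - f (a * ζ)‖ₑ ≤ ∫⁻ x in Set.Ioc a b, ‖deriv f (x * ζ)‖ₑ := by
  have hn : ∀ x ∈ Set.Icc a b, ‖(x : ℂ) * ζ‖ < 1 := fun x hx => by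
    rw [norm_mul, hζ, mul_one, Complex.norm_real, Real.norm_eq_abs, abs_of_nonneg (ha.trans hx.1)]
    linarith [hx.2]
  have hc : ContinuousOn (fun x : ℝ => deriv f (x * ζ) * ζ) (Set.uIcc a b) := by
    rw [Set.uIcc_of_le hab]
    refine ContinuousOn.mul ?_ continuousOn_const
    exact (hf.deriv Metric.isOpen_ball).continuousOn.comp (by fun_prop)
      fun x hx => mem_ball_zero_iff.2 (hn x hx)
  have h := intervalIntegral.integral_eq_sub_of_hasDerivAt (a := a) (b := b)
    (f := fun x : ℝ => f (x * ζ)) (f' := fun x : ℝ => deriv f (x * ζ) * ζ)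
    (fun x hx => hasDerivAt_radius hf (hn x (by rwa [Set.uIcc_of_le hab] at hx)))
    hc.intervalIntegrable
  rw [← h, intervalIntegral.integral_of_le hab]
  refine (enorm_integral_le_lintegral_enorm _).trans (le_of_eq ?_)
  refine lintegral_congr fun x => ?_
  rw [enorm_mul, ← ofReal_norm ζ, hζ, ENNReal.ofReal_one, mul_one]

/-- Points `w` that are close to `z` at hyperbolic scale and close to the centre of `I`. -/
def nearRegion (I : Arc) (z : ℂ) : Set ℂ :=
  {w | ‖w‖ < 1 ∧ ‖z - w‖ ≤ 3 * (1 - ‖w‖) ∧ ‖w - I.center‖ ≤ 5 * I.length}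

lemma measurableSet_nearRegion_prod (I : Arc) :
    MeasurableSet {x : ℂ × ℂ | x.2 ∈ nearRegion I x.1} := by
  have e : {x : ℂ × ℂ | x.2 ∈ nearRegion I x.1} = {x : ℂ × ℂ | ‖x.2‖ < 1} ∩
      ({x : ℂ × ℂ | ‖x.1 - x.2‖ ≤ 3 * (1 - ‖x.2‖)} ∩
        {x : ℂ × ℂ | ‖x.2 - I.center‖ ≤ 5 * I.length}) := rfl
  rw [e]
  exact (measurableSet_lt (by fun_prop) (by fun_prop)).inter
    ((measurableSet_le (by fun_prop) (by fun_prop)).inter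
      (measurableSet_le (by fun_prop) (by fun_prop)))

lemma measurableSet_nearRegion (I : Arc) (z : ℂ) : MeasurableSet (nearRegion I z) :=
  measurable_prodMk_left (measurableSet_nearRegion_prod I)

/-- This fixes the constants of `nearRegion`. The distance from z to w is at most (|z|-ρ) + (1-ρ)/2
≤ 3(1-ρ)/2 ≤ 3(1-|w|), and the distance from w to the midpoint of I is at most (3/2 + π)|I| ≤ 5|I|.
-/
lemma mem_nearRegion_of_mem_ball {I : Arc} {z w : ℂ} (hz : z ∈ tent I) {ρ : ℝ}
    (h0 : 1 - I.length ≤ ρ) (hρ : ρ ≤ ‖z‖)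
    (hw : w ∈ Metric.ball ((ρ : ℂ) * (z / (‖z‖ : ℂ))) ((1 - ρ) / 2)) :
    w ∈ nearRegion I z ∧ (1 - ρ) / 2 ≤ 1 - ‖w‖ ∧ 1 - ‖w‖ ≤ 3 / 2 * (1 - ρ) := by
  set ζ := z / (‖z‖ : ℂ) with hζ
  have hζ1 : ‖ζ‖ = 1 := norm_div_norm_self (ne_zero_of_mem_tent hz)
  have hz1 := hz.2.1
  have hρ0 : 0 ≤ ρ := by linarith [I.length_le_one]
  rw [Metric.mem_ball, dist_eq_norm] at hw
  have hnρ : ‖(ρ : ℂ) * ζ‖ = ρ := by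
    rw [norm_mul, hζ1, mul_one, Complex.norm_real, Real.norm_eq_abs, abs_of_nonneg hρ0]
  have h1 := abs_le.1 (abs_norm_sub_norm_le w ((ρ : ℂ) * ζ))
  rw [hnρ] at h1
  refine ⟨⟨by linarith, ?_, ?_⟩, by linarith, by linarith⟩
  · have e : z - (ρ : ℂ) * ζ = ((‖z‖ - ρ : ℝ) : ℂ) * ζ := by
      push_cast
      rw [sub_mul, norm_mul_div_norm]
    have h2 : ‖z - (ρ : ℂ) * ζ‖ = ‖z‖ - ρ := by
      rw [e, norm_mul, hζ1, mul_one, Complex.norm_real, Real.norm_eq_abs, abs_of_nonneg]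
      linarith
    have h3 := norm_sub_le_norm_sub_add_norm_sub z ((ρ : ℂ) * ζ) w
    rw [norm_sub_rev ((ρ : ℂ) * ζ) w, h2] at h3
    linarith
  · have h2 := I.norm_smul_sub_center_le hz.2.2 (ρ := ρ) (by linarith)
    have h3 := norm_sub_le_norm_sub_add_norm_sub w ((ρ : ℂ) * ζ) I.center
    nlinarith [Real.pi_lt_d2, I.length_pos]

/-- Tonelli along a radius: the averages over hyperbolic discs centred on the radius through `z` are
controlled by one area integral. -/
lemma lintegral_radius_ball_le {I : Arc} {z : ℂ} (hz : z ∈ tent I) {G : ℂ → ℝ≥0∞}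
    (hG : Measurable G) :
    ∫⁻ ρ in Set.Ioc (1 - I.length) ‖z‖,
      ∫⁻ w in Metric.ball (((ρ : ℝ) : ℂ) * (z / (‖z‖ : ℂ))) ((1 - ρ) / 2), G w ≤
    ∫⁻ w in nearRegion I z, G w * ENNReal.ofReal (2 * (1 - ‖w‖)) := by
  set ζ := z / (‖z‖ : ℂ) with hζ
  set S : Set (ℝ × ℂ) := {x | x.1 ∈ Set.Ioc (1 - I.length) ‖z‖ ∧
    ‖x.2 - (x.1 : ℂ) * ζ‖ < (1 - x.1) / 2} with hS
  have hSm : MeasurableSet S := by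
    have e : S = (Prod.fst ⁻¹' Set.Ioc (1 - I.length) ‖z‖) ∩
      {x : ℝ × ℂ | ‖x.2 - (x.1 : ℂ) * ζ‖ < (1 - x.1) / 2} := rfl
    rw [e]
    exact (measurableSet_Ioc.preimage measurable_fst).inter
      (measurableSet_lt (by fun_prop) (by fun_prop))
  have e1 : ∫⁻ ρ in Set.Ioc (1 - I.length) ‖z‖,
      ∫⁻ w in Metric.ball (((ρ : ℝ) : ℂ) * ζ) ((1 - ρ) / 2), G w =
      ∫⁻ ρ : ℝ, ∫⁻ w : ℂ, S.indicator (fun x => G x.2) (ρ, w) := by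
    rw [← lintegral_indicator measurableSet_Ioc]
    refine lintegral_congr fun ρ => ?_
    by_cases hρ : ρ ∈ Set.Ioc (1 - I.length) ‖z‖
    · rw [Set.indicator_of_mem hρ, ← lintegral_indicator measurableSet_ball]
      refine lintegral_congr fun w => ?_
      by_cases hw : w ∈ Metric.ball ((ρ : ℂ) * ζ) ((1 - ρ) / 2)
      · rw [Set.indicator_of_mem hw, Set.indicator_of_mem]
        exact ⟨hρ, by rwa [Metric.mem_ball, dist_eq_norm] at hw⟩
      · rw [Set.indicator_of_notMem hw, Set.indicator_of_notMem]
        rintro ⟨-, h⟩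
        exact hw (by rwa [Metric.mem_ball, dist_eq_norm])
    · rw [Set.indicator_of_notMem hρ]
      symm
      rw [lintegral_eq_zero_iff' (by
        exact (((hG.comp measurable_snd).indicator hSm).comp measurable_prodMk_left).aemeasurable)]
      refine Eventually.of_forall fun w => ?_
      exact Set.indicator_of_notMem (fun h => hρ h.1) _
  have hGS : Measurable (S.indicator fun x => G x.2) := (hG.comp measurable_snd).indicator hSm
  rw [e1, lintegral_lintegral_swap
      (f := fun ρ w => S.indicator (fun x : ℝ × ℂ => G x.2) (ρ, w)) hGS.aemeasurable,
    ← lintegral_indicator (measurableSet_nearRegion I z)]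
  refine lintegral_mono fun w => ?_
  have hmem : ∀ ρ : ℝ, (ρ, w) ∈ S → w ∈ nearRegion I z ∧ (1 - ρ) / 2 ≤ 1 - ‖w‖ := fun ρ h => by
    have := mem_nearRegion_of_mem_ball hz h.1.1.le h.1.2 (w := w)
      (by rw [Metric.mem_ball, dist_eq_norm]; exact h.2)
    exact ⟨this.1, this.2.1⟩
  have hz1 := hz.2.1
  by_cases hw : w ∈ nearRegion I z
  · rw [Set.indicator_of_mem hw]
    -- A given w lies only in discs with 1-ρ ≤ 2(1-|w|), so the admissible ρ fill an interval of
    -- length at most 2(1-|w|).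
    calc ∫⁻ ρ : ℝ, S.indicator (fun x => G x.2) (ρ, w)
        ≤ ∫⁻ ρ : ℝ, (Set.Icc (1 - 2 * (1 - ‖w‖)) 1).indicator (fun _ => G w) ρ := by
          refine lintegral_mono fun ρ => ?_
          by_cases h : (ρ, w) ∈ S
          · rw [Set.indicator_of_mem h, Set.indicator_of_mem]
            have h2 := (hmem ρ h).2
            exact ⟨by linarith, h.1.2.trans hz1.le⟩
          · rw [Set.indicator_of_notMem h]
            exact zero_le
      _ = _ := by
          rw [lintegral_indicator measurableSet_Icc, setLIntegral_const, Real.volume_Icc]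
          congr 2; ring
  · rw [Set.indicator_of_notMem hw]
    refine le_of_eq ?_
    rw [← lintegral_zero (μ := (volume : Measure ℝ))]
    refine lintegral_congr fun ρ => ?_
    exact Set.indicator_of_notMem (fun h => hw (hmem ρ h).1) _

/-- The submean value property on a disc where 1-|w| is comparable to 1-ρ. The extra exponent 2 is
the area of the disc, the factor 4 its radius (1-ρ)/2. -/
lemma enorm_deriv_rpow_le_lintegral_ball (c : ℝ) {p : ℝ} (hp : 1 < p) {f : ℂ → ℂ}
    (hf : DifferentiableOn ℂ f disc) {I : Arc} {z : ℂ} (hz : z ∈ tent I) {ρ : ℝ}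
    (h0 : 1 - I.length ≤ ρ) (hρ : ρ ≤ ‖z‖) :
    ‖deriv f (ρ * (z / (‖z‖ : ℂ)))‖ₑ ^ p * ENNReal.ofReal ((1 - ρ) ^ (c + 2)) ≤
      ENNReal.ofReal (4 * 2 ^ |c|) * ∫⁻ w in Metric.ball ((ρ : ℂ) * (z / (‖z‖ : ℂ))) ((1 - ρ) / 2),
        ‖deriv f w‖ₑ ^ p * ENNReal.ofReal ((1 - ‖w‖) ^ c) := by
  have hd : 0 < 1 - ρ := by linarith [hz.2.1]
  set u := (ρ : ℂ) * (z / (‖z‖ : ℂ)) with hu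
  have hball := fun w (hw : w ∈ Metric.ball u ((1 - ρ) / 2)) =>
    mem_nearRegion_of_mem_ball hz h0 hρ hw
  have h1 := enorm_rpow_mul_le_ball (half_pos hd) hp (measurable_deriv f)
    ((hf.deriv Metric.isOpen_ball).mono fun w hw => mem_ball_zero_iff.2 (hball w hw).1.1)
  calc ‖deriv f u‖ₑ ^ p * ENNReal.ofReal ((1 - ρ) ^ (c + 2))
      = ENNReal.ofReal (4 * (1 - ρ) ^ c) *
          (‖deriv f u‖ₑ ^ p * ENNReal.ofReal (((1 - ρ) / 2) ^ 2)) := by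
        rw [mul_left_comm, ← ENNReal.ofReal_mul (by positivity), Real.rpow_add hd]
        congr 2
        norm_num
        ring
    _ ≤ ENNReal.ofReal (4 * (1 - ρ) ^ c) * ∫⁻ w in Metric.ball u ((1 - ρ) / 2),
          ‖deriv f w‖ₑ ^ p := by gcongr
    _ ≤ _ := by
        rw [← lintegral_const_mul' _ _ ENNReal.ofReal_ne_top,
          ← lintegral_const_mul' _ _ ENNReal.ofReal_ne_top]
        refine setLIntegral_mono' measurableSet_ball fun w hw => ?_
        rw [mul_left_comm, mul_comm, ← ENNReal.ofReal_mul (by positivity)]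
        have hb := hball w hw
        refine mul_le_mul' le_rfl (ENNReal.ofReal_le_ofReal ?_)
        rw [mul_assoc]
        refine mul_le_mul_of_nonneg_left ?_ (by norm_num)
        exact rpow_le_of_comparable hd (by linarith) one_le_two (by linarith) (by linarith) c

/-- The increment of `f` along a radius of a tent is controlled by an area integral of `f'`. -/
lemma enorm_sub_rpow_le_lintegral_nearRegion {p η : ℝ} (hp : 1 < p) (hη : 0 < η) :
    ∃ C : ℝ, 0 < C ∧ ∀ {f : ℂ → ℂ} (_ : DifferentiableOn ℂ f disc) {I : Arc} {z : ℂ}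
    (_ : z ∈ tent I),
    ‖f z - f (((1 - I.length : ℝ) : ℂ) * (z / (‖z‖ : ℂ)))‖ₑ ^ p ≤
      ENNReal.ofReal (C * I.length ^ η) * ∫⁻ w in nearRegion I z,
        ‖deriv f w‖ₑ ^ p * ENNReal.ofReal ((1 - ‖w‖) ^ (p - 2 - η)) := by
  have hp1 : 0 < p - 1 := by linarith
  have hp0 : 0 < p := by linarith
  -- Hölder's inequality uses the weight (1-x)^b with b = (p-1-η)/p. The dual factor is then the
  -- integral of (1-x)^(ε-1), at most |I|^ε/ε, whose power p-1 yields |I|^η. The submean value step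
  -- lowers the exponent p-1-η to c = p-3-η, and Tonelli's theorem raises it to p-2-η.
  set ε := η / (p - 1) with hε
  have hε0 : 0 < ε := by positivity
  set c := p - 3 - η with hc
  refine ⟨(1 / ε) ^ (p - 1) * (4 * 2 ^ |c|) * 2, by positivity, fun {f} hf {I z} hz => ?_⟩
  set ζ := z / (‖z‖ : ℂ) with hζ
  have hζ1 : ‖ζ‖ = 1 := norm_div_norm_self (ne_zero_of_mem_tent hz)
  have hz1 := hz.2.1
  have hI0 := I.length_pos
  have hI1 := I.length_le_one
  have h1 := enorm_sub_le_lintegral_radius hf hζ1 (a := 1 - I.length) (by linarith) hz.1.le hz1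
  have hzζ : (‖z‖ : ℂ) * ζ = z := norm_mul_div_norm z
  rw [hzζ] at h1
  set b := (c + 2) / p with hb
  have hd : ∀ ρ ∈ Set.Ioc (1 - I.length) ‖z‖, 0 < 1 - ρ := fun ρ hρ => by linarith [hρ.2]
  have h2 : ∫⁻ x in Set.Ioc (1 - I.length) ‖z‖, ‖deriv f (x * ζ)‖ₑ =
      ∫⁻ x in Set.Ioc (1 - I.length) ‖z‖, (‖deriv f (x * ζ)‖ₑ * ENNReal.ofReal ((1 - x) ^ b)) *
        ENNReal.ofReal ((1 - x) ^ (-b)) := by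
    refine setLIntegral_congr_fun measurableSet_Ioc fun x hx => ?_
    have hx' := hd x hx
    rw [mul_assoc, ← ENNReal.ofReal_mul (by positivity), ← Real.rpow_add hx']
    simp
  have hmd : Measurable fun x : ℝ => ‖deriv f (x * ζ)‖ₑ :=
    ((measurable_deriv f).comp (by fun_prop)).enorm
  have h3 := lintegral_mul_rpow_le (volume.restrict (Set.Ioc (1 - I.length) ‖z‖)) hp
    (f := fun x : ℝ => ‖deriv f (x * ζ)‖ₑ * ENNReal.ofReal ((1 - x) ^ b))
    (g := fun x : ℝ => ENNReal.ofReal ((1 - x) ^ (-b)))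
    (by fun_prop) (by fun_prop)
  rw [← h2] at h3
  have h4 : ∫⁻ x in Set.Ioc (1 - I.length) ‖z‖,
      ENNReal.ofReal ((1 - x) ^ (-b)) ^ (p / (p - 1)) ≤ ENNReal.ofReal (I.length ^ ε * (1 / ε)) := by
    calc _ = ∫⁻ x in Set.Ioc (1 - I.length) ‖z‖, ENNReal.ofReal ((1 - x) ^ (ε - 1)) := by
          refine setLIntegral_congr_fun measurableSet_Ioc fun x hx => ?_
          have hx' := hd x hx
          rw [ENNReal.ofReal_rpow_of_nonneg (by positivity) (by positivity),
            ← Real.rpow_mul hx'.le]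
          congr 2
          rw [hb, hc, hε]
          field_simp
          ring
      _ ≤ ∫⁻ x in Set.Ico (1 - I.length) 1, ENNReal.ofReal ((1 - x) ^ (ε - 1)) :=
          lintegral_mono_set fun x hx => ⟨hx.1.le, by linarith [hx.2]⟩
      _ = _ := by
          rw [lintegral_one_sub_rpow (by linarith) hI0.le, sub_add_cancel, mul_one_div]
  have h5 : ∫⁻ x in Set.Ioc (1 - I.length) ‖z‖,
      (‖deriv f (x * ζ)‖ₑ * ENNReal.ofReal ((1 - x) ^ b)) ^ p ≤
      ENNReal.ofReal (4 * 2 ^ |c|) * (ENNReal.ofReal 2 * ∫⁻ w in nearRegion I z,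
        ‖deriv f w‖ₑ ^ p * ENNReal.ofReal ((1 - ‖w‖) ^ (p - 2 - η))) := by
    calc _ ≤ ∫⁻ x in Set.Ioc (1 - I.length) ‖z‖, ENNReal.ofReal (4 * 2 ^ |c|) *
            ∫⁻ w in Metric.ball (((x : ℝ) : ℂ) * ζ) ((1 - x) / 2),
              ‖deriv f w‖ₑ ^ p * ENNReal.ofReal ((1 - ‖w‖) ^ c) := by
          refine setLIntegral_mono' measurableSet_Ioc fun x hx => ?_
          have hx' := hd x hx
          rw [ENNReal.mul_rpow_of_nonneg _ _ hp0.le,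
            ENNReal.ofReal_rpow_of_nonneg (by positivity) hp0.le, ← Real.rpow_mul hx'.le, hb,
            div_mul_cancel₀ _ hp0.ne']
          exact enorm_deriv_rpow_le_lintegral_ball c hp hf hz hx.1.le hx.2
      _ ≤ ENNReal.ofReal (4 * 2 ^ |c|) * ∫⁻ w in nearRegion I z,
            (‖deriv f w‖ₑ ^ p * ENNReal.ofReal ((1 - ‖w‖) ^ c)) *
              ENNReal.ofReal (2 * (1 - ‖w‖)) := by
          rw [lintegral_const_mul' _ _ ENNReal.ofReal_ne_top]
          gcongr
          exact lintegral_radius_ball_le hz (by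
            exact ((measurable_deriv f).enorm.pow_const p).mul (by fun_prop))
      _ = _ := by
          congr 1
          rw [← lintegral_const_mul' _ _ ENNReal.ofReal_ne_top]
          refine setLIntegral_congr_fun (measurableSet_nearRegion I z) fun w hw => ?_
          have hw' : 0 < 1 - ‖w‖ := by linarith [hw.1]
          rw [mul_assoc, mul_left_comm (ENNReal.ofReal 2), ← ENNReal.ofReal_mul (by positivity),
            ← ENNReal.ofReal_mul (by positivity)]
          congr 2
          rw [show p - 2 - η = c + 1 by rw [hc]; ring, Real.rpow_add_one hw'.ne']
          ring
  calc _ ≤ (∫⁻ x in Set.Ioc (1 - I.length) ‖z‖, ‖deriv f (x * ζ)‖ₑ) ^ p :=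
        ENNReal.rpow_le_rpow h1 hp0.le
    _ ≤ _ := h3
    _ ≤ (ENNReal.ofReal (4 * 2 ^ |c|) * (ENNReal.ofReal 2 * ∫⁻ w in nearRegion I z,
        ‖deriv f w‖ₑ ^ p * ENNReal.ofReal ((1 - ‖w‖) ^ (p - 2 - η)))) *
          ENNReal.ofReal (I.length ^ ε * (1 / ε)) ^ (p - 1) := by gcongr
    _ = _ := by
        have e : ENNReal.ofReal (I.length ^ ε * (1 / ε)) ^ (p - 1) =
            ENNReal.ofReal ((1 / ε) ^ (p - 1) * I.length ^ η) := by
          rw [ENNReal.ofReal_rpow_of_nonneg (by positivity) hp1.le,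
            Real.mul_rpow (by positivity) (by positivity), ← Real.rpow_mul hI0.le, hε,
            div_mul_cancel₀ _ hp1.ne', mul_comm]
        rw [e, ← mul_assoc, mul_right_comm, ← ENNReal.ofReal_mul (by positivity),
          ← ENNReal.ofReal_mul (by positivity)]
        congr 2
        ring

/-! ### The Carleson embedding. -/

lemma Arc.isCompact_points (I : Arc) : IsCompact I.points :=
  isCompact_Icc.image (by fun_prop)

lemma measurableSet_tent (I : Arc) : MeasurableSet (tent I) := by
  have e : tent I = {z : ℂ | 1 - I.length < ‖z‖} ∩ ({z : ℂ | ‖z‖ < 1} ∩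
      (fun z : ℂ => z / (‖z‖ : ℂ)) ⁻¹' I.points) := rfl
  rw [e]
  exact (measurableSet_lt (by fun_prop) (by fun_prop)).inter
    ((measurableSet_lt (by fun_prop) (by fun_prop)).inter
      (I.isCompact_points.isClosed.measurableSet.preimage (by fun_prop)))

/-- All such z satisfy |z-w| ≤ 3(1-|w|), so they lie in one tent over an arc of length at most
8(1-|w|), where 8 = 2·3 + 2. -/
lemma measure_tent_inter_near_le {ν : Measure ℂ} {N σ : ℝ} (hN : 0 ≤ N) (hσ : 0 < σ)
    (hν : ∀ J : Arc, ν (tent J) ≤ ENNReal.ofReal (N * J.length ^ σ)) (I : Arc) {w : ℂ}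
    (hw : ‖w‖ < 1) :
    ν (tent I ∩ {z | w ∈ nearRegion I z}) ≤ ENNReal.ofReal (N * 8 ^ σ * (1 - ‖w‖) ^ σ) := by
  obtain ⟨J, hJ, hJw⟩ := exists_tent_of_near hw (A := 3) (by norm_num)
  have hd : 0 < 1 - ‖w‖ := by linarith
  have hJ0 := J.length_pos
  calc _ ≤ ν (tent J) := measure_mono fun z hz => hJw z (ne_zero_of_mem_tent hz.1) hz.1.2.1 hz.2.2.1
    _ ≤ _ := hν J
    _ ≤ _ := by
        apply ENNReal.ofReal_le_ofReal
        rw [mul_assoc, ← Real.mul_rpow (by norm_num) hd.le]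
        have := Real.rpow_le_rpow hJ0.le hJ hσ.le
        norm_num at this
        gcongr

/-- Tonelli's theorem: with w fixed, the inner integral is the ν-mass of the z near w, which is
controlled by one tent. -/
lemma lintegral_tent_nearRegion_le {ν : Measure ℂ} [SFinite ν] {N σ : ℝ} (hN : 0 ≤ N) (hσ : 0 < σ)
    (hν : ∀ J : Arc, ν (tent J) ≤ ENNReal.ofReal (N * J.length ^ σ)) (I : Arc) {G : ℂ → ℝ≥0∞}
    (hG : Measurable G) :
    ∫⁻ z in tent I, (∫⁻ w in nearRegion I z, G w) ∂ν ≤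
      ENNReal.ofReal (N * 8 ^ σ) * ∫⁻ w in disc ∩ Metric.closedBall I.center (5 * I.length),
        G w * ENNReal.ofReal ((1 - ‖w‖) ^ σ) := by
  set S : Set (ℂ × ℂ) := {x : ℂ × ℂ | x.2 ∈ nearRegion I x.1} with hS
  have hSm : MeasurableSet S := measurableSet_nearRegion_prod I
  have hGS : Measurable (S.indicator fun x => G x.2) := (hG.comp measurable_snd).indicator hSm
  have e1 : ∀ z, ∫⁻ w in nearRegion I z, G w = ∫⁻ w, S.indicator (fun x => G x.2) (z, w) := fun z => by
    rw [← lintegral_indicator (measurableSet_nearRegion I z)]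
    rfl
  simp only [e1]
  rw [lintegral_lintegral_swap
      (f := fun z w => S.indicator (fun x : ℂ × ℂ => G x.2) (z, w)) hGS.aemeasurable,
    ← lintegral_const_mul' _ _ ENNReal.ofReal_ne_top,
    ← lintegral_indicator (measurableSet_ball.inter measurableSet_closedBall)]
  refine lintegral_mono fun w => ?_
  by_cases hw : w ∈ disc ∩ Metric.closedBall I.center (5 * I.length)
  · rw [Set.indicator_of_mem hw]
    have hw1 : ‖w‖ < 1 := mem_ball_zero_iff.1 hw.1
    have hm : MeasurableSet {z | w ∈ nearRegion I z} := measurable_prodMk_right hSm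
    calc ∫⁻ z in tent I, S.indicator (fun x => G x.2) (z, w) ∂ν
        = ∫⁻ z in tent I, {z | w ∈ nearRegion I z}.indicator (fun _ => G w) z ∂ν := rfl
      _ = G w * ν (tent I ∩ {z | w ∈ nearRegion I z}) := by
          rw [lintegral_indicator hm, setLIntegral_const, Measure.restrict_apply hm, Set.inter_comm]
      _ ≤ G w * ENNReal.ofReal (N * 8 ^ σ * (1 - ‖w‖) ^ σ) := by
          gcongr
          exact measure_tent_inter_near_le hN hσ hν I hw1
      _ = _ := by
          rw [mul_left_comm, ← ENNReal.ofReal_mul (by positivity)]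
  · rw [Set.indicator_of_notMem hw]
    refine le_of_eq ?_
    rw [← lintegral_zero (μ := ν.restrict (tent I))]
    refine lintegral_congr fun z => Set.indicator_of_notMem (fun h => hw ?_) _
    exact ⟨mem_ball_zero_iff.2 h.1, by rw [Metric.mem_closedBall, dist_eq_norm]; exact h.2.2⟩

/-- Carleson measures of order `s + p (α - 1)` embed `F(p, pα - 2, t)`, `t < s`, into the tent
space, with an explicit dependence on the Carleson constant. -/
lemma FBound.lintegral_tent_le {α p s t : ℝ} (hα : 1 < α) (hp : 1 < p) (ht : 0 < t) (hts : t < s) :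
    ∃ C : ℝ, 0 < C ∧ ∀ {ν : Measure ℂ} [SFinite ν] {N : ℝ} (_ : 0 ≤ N)
    (_ : ∀ J : Arc, ν (tent J) ≤ ENNReal.ofReal (N * J.length ^ (s + p * (α - 1))))
    {M : ℝ} {f : ℂ → ℂ} (_ : FBound p (p * α - 2) t M f) (I : Arc),
    ∫⁻ z in tent I, ‖f z‖ₑ ^ p ∂ν ≤ ENNReal.ofReal (C * N * M ^ p * I.length ^ s) := by
  obtain ⟨C₁, hC₁, hgrow⟩ := FBound.norm_le hp hα ht
  obtain ⟨C₂, hC₂, hnear⟩ := FBound.lintegral_near_le (q := p * α - 2) ht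
  obtain ⟨C₃, hC₃, hinc⟩ := enorm_sub_rpow_le_lintegral_nearRegion hp (sub_pos.2 hts)
  have hp0 : 0 < p := by linarith
  set σ := s + p * (α - 1) with hσ
  have hσ0 : 0 < σ := by
    have : 0 < p * (α - 1) := mul_pos hp0 (by linarith)
    linarith
  refine ⟨2 ^ (p - 1) * (C₃ * (8 ^ σ * C₂) + C₁ ^ p), by positivity,
    fun {ν} _ {N} hN hν {M f} h I => ?_⟩
  have hM := h.nonneg
  have hI0 := I.length_pos
  have hI1 := I.length_le_one
  set v : ℂ → ℂ := fun z => ((1 - I.length : ℝ) : ℂ) * (z / (‖z‖ : ℂ)) with hv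
  -- The increment estimate is applied with η = s - t. Multiplying by (1-|w|)^σ, the exponent
  -- becomes p-2-(s-t)+s+p(α-1) = pα-2+t, the weight of `FBound.lintegral_near_le`.
  set G : ℂ → ℝ≥0∞ := fun w => ‖deriv f w‖ₑ ^ p * ENNReal.ofReal ((1 - ‖w‖) ^ (p - 2 - (s - t)))
    with hG
  have hGm : Measurable G := ((measurable_deriv f).enorm.pow_const p).mul (by fun_prop)
  have hfar : ∀ z ∈ tent I, ‖f (v z)‖ₑ ^ p ≤
      ENNReal.ofReal (C₁ ^ p * M ^ p * I.length ^ (p * (1 - α))) := by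
    intro z hz
    have hnv : ‖v z‖ = 1 - I.length := by
      rw [hv]
      simp only
      rw [norm_mul, norm_div_norm_self (ne_zero_of_mem_tent hz), mul_one, Complex.norm_real,
        Real.norm_eq_abs, abs_of_nonneg (by linarith)]
    have h1 := hgrow h (z := v z) (by linarith)
    rw [hnv, sub_sub_cancel] at h1
    rw [enorm_rpow_eq_ofReal _ hp0.le]
    apply ENNReal.ofReal_le_ofReal
    refine (Real.rpow_le_rpow (norm_nonneg _) h1 hp0.le).trans (le_of_eq ?_)
    rw [Real.mul_rpow (by positivity) (by positivity), Real.mul_rpow hC₁.le hM,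
      ← Real.rpow_mul hI0.le, mul_comm p]
  have hfar2 : ENNReal.ofReal (C₁ ^ p * M ^ p * I.length ^ (p * (1 - α))) * ν (tent I) ≤
      ENNReal.ofReal (C₁ ^ p * (N * M ^ p * I.length ^ s)) := by
    refine (mul_le_mul' le_rfl (hν I)).trans (le_of_eq ?_)
    rw [← ENNReal.ofReal_mul (by positivity)]
    congr 1
    have : I.length ^ s = I.length ^ (p * (1 - α)) * I.length ^ σ := by
      rw [← Real.rpow_add hI0]
      congr 1
      rw [hσ]; ring
    rw [this]
    ring
  have hnear2 : ∫⁻ z in tent I, (∫⁻ w in nearRegion I z, G w) ∂ν ≤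
      ENNReal.ofReal (N * 8 ^ σ) * ENNReal.ofReal (C₂ * I.length ^ t * M ^ p) := by
    refine (lintegral_tent_nearRegion_le hN hσ0 hν I hGm).trans (mul_le_mul' le_rfl ?_)
    refine le_trans (le_of_eq ?_) (hnear h I.norm_center hI0 hI1)
    refine setLIntegral_congr_fun (measurableSet_ball.inter measurableSet_closedBall) fun w hw => ?_
    have hd : 0 < 1 - ‖w‖ := by linarith [mem_ball_zero_iff.1 hw.1]
    rw [hG]
    simp only
    rw [mul_assoc, ← ENNReal.ofReal_mul (by positivity), ← Real.rpow_add hd]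
    congr 3
    rw [hσ]; ring
  calc ∫⁻ z in tent I, ‖f z‖ₑ ^ p ∂ν
      ≤ ∫⁻ z in tent I, ENNReal.ofReal (2 ^ (p - 1)) *
          (ENNReal.ofReal (C₃ * I.length ^ (s - t)) * (∫⁻ w in nearRegion I z, G w) +
            ENNReal.ofReal (C₁ ^ p * M ^ p * I.length ^ (p * (1 - α)))) ∂ν := by
        refine setLIntegral_mono' (measurableSet_tent I) fun z hz => ?_
        have e : ‖f z‖ₑ ≤ ‖f z - f (v z)‖ₑ + ‖f (v z)‖ₑ := by
          conv_lhs => rw [← sub_add_cancel (f z) (f (v z))]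
          exact enorm_add_le _ _
        refine (ENNReal.rpow_le_rpow e hp0.le).trans
          ((ENNReal.rpow_add_le_mul_rpow_add_rpow _ _ hp.le).trans ?_)
        have e2 : (2 : ℝ≥0∞) ^ (p - 1) = ENNReal.ofReal (2 ^ (p - 1)) := by
          rw [← ENNReal.ofReal_rpow_of_pos two_pos]
          simp
        rw [e2]
        exact mul_le_mul' le_rfl (add_le_add (hinc h.diff hz) (hfar z hz))
    _ = ENNReal.ofReal (2 ^ (p - 1)) * (ENNReal.ofReal (C₃ * I.length ^ (s - t)) *
          (∫⁻ z in tent I, (∫⁻ w in nearRegion I z, G w) ∂ν) +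
            ENNReal.ofReal (C₁ ^ p * M ^ p * I.length ^ (p * (1 - α))) * ν (tent I)) := by
        rw [lintegral_const_mul' _ _ ENNReal.ofReal_ne_top, lintegral_add_right _ measurable_const,
          lintegral_const_mul' _ _ ENNReal.ofReal_ne_top, setLIntegral_const]
    _ ≤ ENNReal.ofReal (2 ^ (p - 1)) * (ENNReal.ofReal (C₃ * I.length ^ (s - t)) *
          (ENNReal.ofReal (N * 8 ^ σ) * ENNReal.ofReal (C₂ * I.length ^ t * M ^ p)) +
            ENNReal.ofReal (C₁ ^ p * (N * M ^ p * I.length ^ s))) := by gcongr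
    _ = _ := by
        rw [← ENNReal.ofReal_mul (by positivity), ← ENNReal.ofReal_mul (by positivity),
          ← ENNReal.ofReal_add (by positivity) (by positivity),
          ← ENNReal.ofReal_mul (by positivity)]
        congr 1
        have : I.length ^ s = I.length ^ (s - t) * I.length ^ t := by
          rw [← Real.rpow_add hI0, sub_add_cancel]
        rw [this]
        ring

/-! ### Normal families and sequential compactness of norm balls. -/

/-- The Arzelà-Ascoli argument: a product of compact discs gives a subsequence converging on a
countable dense set, and the uniform Lipschitz bounds extend the convergence to the whole disc,
locally uniformly. -/
lemma exists_subseq_tendstoLocallyUniformlyOn {F : ℕ → ℂ → ℂ} {B : ℂ → ℝ}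
    (hB : ∀ n, ∀ z ∈ disc, ‖F n z‖ ≤ B z)
    (hL : ∀ r < (1 : ℝ), ∃ L : ℝ, 0 < L ∧ ∀ n, ∀ z w : ℂ, ‖z‖ ≤ r → ‖w‖ ≤ r →
      ‖F n z - F n w‖ ≤ L * ‖z - w‖) :
    ∃ (φ : ℕ → ℕ) (f : ℂ → ℂ), StrictMono φ ∧
      TendstoLocallyUniformlyOn (fun n => F (φ n)) f atTop disc := by
  have : Nonempty disc := ⟨⟨0, by simp⟩⟩
  set D : ℕ → disc := TopologicalSpace.denseSeq disc with hD
  have hcomp : IsCompact (Set.pi Set.univ fun k => Metric.closedBall (0 : ℂ) (B (D k))) :=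
    isCompact_univ_pi fun k => isCompact_closedBall _ _
  obtain ⟨g, -, φ, hφ, hg⟩ := hcomp.tendsto_subseq (x := fun n k => F n (D k))
    (fun n k _ => mem_closedBall_zero_iff.2 (hB n _ (D k).2))
  rw [tendsto_pi_nhds] at hg
  have hcauchy : ∀ z ∈ disc, CauchySeq fun n => F (φ n) z := by
    intro z hz
    rw [mem_ball_zero_iff] at hz
    obtain ⟨L, hL0, hL⟩ := hL ((1 + ‖z‖) / 2) (by linarith)
    rw [Metric.cauchySeq_iff]
    intro ε hε
    set δ := min (ε / (3 * L)) ((1 - ‖z‖) / 2) with hδ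
    have hδ0 : 0 < δ := lt_min (by positivity) (by linarith)
    obtain ⟨k, hk⟩ := (TopologicalSpace.denseRange_denseSeq disc).exists_dist_lt
      ⟨z, mem_ball_zero_iff.2 hz⟩ hδ0
    rw [Subtype.dist_eq, dist_eq_norm] at hk
    change ‖z - D k‖ < δ at hk
    have hk1 : ‖z - D k‖ < ε / (3 * L) := hk.trans_le (min_le_left _ _)
    have hk2 : ‖(D k : ℂ)‖ ≤ (1 + ‖z‖) / 2 := by
      have h1 := hk.trans_le (min_le_right _ _)
      have h2 := norm_sub_norm_le (D k : ℂ) z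
      rw [norm_sub_rev] at h2
      linarith
    obtain ⟨N, hN⟩ := Metric.cauchySeq_iff.1 (hg k).cauchySeq (ε / 3) (by positivity)
    refine ⟨N, fun m hm n hn => ?_⟩
    have h3 := hN m hm n hn
    have h4 : ∀ j, ‖F (φ j) z - F (φ j) (D k)‖ < ε / 3 := fun j => by
      refine (hL (φ j) z (D k) (by linarith) hk2).trans_lt ?_
      rw [lt_div_iff₀ (by positivity)] at hk1
      linarith
    simp only [Function.comp_apply] at h3
    have h5 := h4 m
    have h6 := h4 n
    rw [← dist_eq_norm] at h5 h6
    have h7 := dist_triangle4_right (F (φ m) z) (F (φ n) z) (F (φ m) (D k)) (F (φ n) (D k))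
    linarith
  have hlim : ∀ z : ℂ, ∃ y, z ∈ disc → Tendsto (fun n => F (φ n) z) atTop (𝓝 y) := fun z => by
    by_cases hz : z ∈ disc
    · obtain ⟨y, hy⟩ := cauchySeq_tendsto_of_complete (hcauchy z hz)
      exact ⟨y, fun _ => hy⟩
    · exact ⟨0, fun h => absurd h hz⟩
  choose f hf using hlim
  refine ⟨φ, f, hφ, ?_⟩
  rw [Metric.tendstoLocallyUniformlyOn_iff]
  intro ε hε x hx
  have hx' := mem_ball_zero_iff.1 hx
  obtain ⟨L, hL0, hL⟩ := hL ((1 + ‖x‖) / 2) (by linarith)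
  set δ := min (ε / (3 * L)) ((1 - ‖x‖) / 2) with hδ
  have hδ0 : 0 < δ := lt_min (by positivity) (by linarith)
  refine ⟨Metric.ball x δ, mem_nhdsWithin_of_mem_nhds (Metric.ball_mem_nhds x hδ0), ?_⟩
  filter_upwards [Metric.tendsto_nhds.1 (hf x hx) (ε / 3) (by positivity)] with n hn y hy
  rw [Metric.mem_ball, dist_eq_norm] at hy
  have hy1 : ‖y - x‖ < ε / (3 * L) := hy.trans_le (min_le_left _ _)
  have hy2 : ‖y‖ ≤ (1 + ‖x‖) / 2 := by
    have h1 := hy.trans_le (min_le_right _ _)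
    have h2 := norm_sub_norm_le y x
    linarith
  have hy3 : y ∈ disc := mem_ball_zero_iff.2 (by linarith)
  rw [lt_div_iff₀ (by positivity)] at hy1
  have h4 : ∀ j, ‖F (φ j) y - F (φ j) x‖ ≤ L * ‖y - x‖ := fun j =>
    hL (φ j) y x hy2 (by linarith)
  have h5 : ‖f y - f x‖ ≤ L * ‖y - x‖ :=
    le_of_tendsto ((hf y hy3).sub (hf x hx)).norm (Eventually.of_forall h4)
  have h6 := h4 n
  rw [← dist_eq_norm] at h5 h6
  have h7 := dist_triangle4_right (f y) (F (φ n) y) (f x) (F (φ n) x)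
  rw [dist_comm] at hn
  linarith

/-- Locally uniform convergence passes to derivatives, and Fatou's lemma passes each integral bound
to the limit without loss. Hence the sets `FBound` are closed. -/
lemma FBound.of_tendsto {p q t M : ℝ} {F : ℕ → ℂ → ℂ} {f : ℂ → ℂ}
    (hF : ∀ n, FBound p q t M (F n)) (h : TendstoLocallyUniformlyOn F f atTop disc) :
    FBound p q t M f := by
  have hdiff := h.differentiableOn (Eventually.of_forall fun n => (hF n).diff) Metric.isOpen_ball
  have hder := h.deriv (Eventually.of_forall fun n => (hF n).diff) Metric.isOpen_ball
  refine ⟨hdiff, le_of_tendsto (h.tendsto_at (by simp)).norm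
    (Eventually.of_forall fun n => (hF n).zero_le), fun a => ?_⟩
  calc ∫⁻ z in disc, ‖deriv f z‖ₑ ^ p * ENNReal.ofReal (fWeight q t a z)
      = ∫⁻ z in disc, liminf
          (fun n => ‖deriv (F n) z‖ₑ ^ p * ENNReal.ofReal (fWeight q t a z)) atTop := by
        refine setLIntegral_congr_fun measurableSet_ball fun z hz => ?_
        refine (Tendsto.liminf_eq ?_).symm
        refine ENNReal.Tendsto.mul_const ?_ (Or.inr ENNReal.ofReal_ne_top)
        exact ((ENNReal.continuous_rpow_const (y := p)).tendsto _).comp (hder.tendsto_at hz).enorm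
    _ ≤ liminf (fun n => ∫⁻ z in disc,
          ‖deriv (F n) z‖ₑ ^ p * ENNReal.ofReal (fWeight q t a z)) atTop :=
        lintegral_liminf_le fun n => ((measurable_deriv (F n)).enorm.pow_const p).mul
          (measurable_fWeight q t a).ennreal_ofReal
    _ ≤ ENNReal.ofReal (M ^ p) :=
        liminf_le_of_le (by isBoundedDefault) fun b hb => by
          obtain ⟨n, hn⟩ := hb.exists
          exact hn.trans ((hF n).lintegral_le a)

/-- Balls of `F(p, pα - 2, t)` are sequentially compact for pointwise convergence. -/
lemma FBound.exists_subseq {p α t M : ℝ} (hp : 1 < p) (hα : 1 < α) (ht : 0 < t) {F : ℕ → ℂ → ℂ}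
    (hF : ∀ n, FBound p (p * α - 2) t M (F n)) :
    ∃ (φ : ℕ → ℕ) (f : ℂ → ℂ), StrictMono φ ∧ FBound p (p * α - 2) t M f ∧
      ∀ z ∈ disc, Tendsto (fun n => F (φ n) z) atTop (𝓝 (f z)) := by
  obtain ⟨C₁, hC₁, hgrow⟩ := FBound.norm_le hp hα ht
  obtain ⟨C₂, hC₂, hlip⟩ := FBound.norm_sub_le hp hα ht
  have hM := (hF 0).nonneg
  obtain ⟨φ, f, hφ, hf⟩ := exists_subseq_tendstoLocallyUniformlyOn (F := F)
    (B := fun z => C₁ * M * (1 - ‖z‖) ^ (1 - α))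
    (fun n z hz => hgrow (hF n) (mem_ball_zero_iff.1 hz))
    (fun r hr => ⟨C₂ * M * (1 - r) ^ (-α) + 1, by
      have : 0 < 1 - r := by linarith
      positivity, fun n z w hz hw =>
      (hlip (hF n) hr hz hw).trans (by nlinarith [norm_nonneg (z - w)])⟩)
  exact ⟨φ, f, hφ, FBound.of_tendsto (fun n => hF (φ n)) hf,
    fun z hz => hf.tendsto_at hz⟩

lemma FBound.sub {p q t M : ℝ} (hp : 1 ≤ p) {f g : ℂ → ℂ} (hf : FBound p q t M f)
    (hg : FBound p q t M g) : FBound p q t (4 * M) (f - g) := by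
  have hM := hf.nonneg
  have hp0 : 0 < p := by linarith
  refine FBound.of_fENorm_le hp0 (by positivity) (hf.diff.sub hg.diff) ?_
  have hg2 : fENorm p q t ((-1 : ℂ) • g) = fENorm p q t g := by rw [fENorm_smul hp]; simp
  have h := fENorm_add_le (p := p) (q := q) (s := t) hp hf.diff (hg.diff.const_smul (-1 : ℂ))
  rw [hg2, neg_one_smul, ← sub_eq_add_neg] at h
  refine h.trans ((add_le_add (hf.fENorm_le hp0) (hg.fENorm_le hp0)).trans (le_of_eq ?_))
  rw [← ENNReal.ofReal_add (by positivity) (by positivity)]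
  congr 1
  ring

/-! ### Finiteness and small Carleson constants of vanishing Carleson measures. -/

lemma tent_subset_punctured (I : Arc) : tent I ⊆ disc \ {0} :=
  fun _ hz => ⟨tent_subset I hz, ne_zero_of_mem_tent hz⟩

lemma IsVanishingCarleson.exists_forall_le {σ : ℝ} {μ : Measure ℂ} (h : IsVanishingCarleson σ μ)
    {ε : ℝ} (hε : 0 < ε) : ∃ δ : ℝ, 0 < δ ∧
      ∀ I : Arc, I.length < δ → μ (tent I) ≤ ENNReal.ofReal (ε * I.length ^ σ) := by
  have h1 := ENNReal.tendsto_nhds_zero.1 h (ENNReal.ofReal ε) (ENNReal.ofReal_pos.2 hε)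
  rw [eventually_comap] at h1
  obtain ⟨δ, hδ, hδ2⟩ := Metric.eventually_nhds_iff.1 h1
  refine ⟨δ, hδ, fun I hI => ?_⟩
  have h2 := hδ2 (y := I.length) (by
    rw [Real.dist_eq, sub_zero, abs_of_pos I.length_pos]; exact hI) I rfl
  have h3 : 0 < I.length ^ σ := Real.rpow_pos_of_pos I.length_pos _
  rw [ENNReal.div_le_iff (ENNReal.ofReal_pos.2 h3).ne' ENNReal.ofReal_ne_top,
    ← ENNReal.ofReal_mul hε.le] at h2
  exact h2

/-- The restricted measure is finite near every point of the closed disc: near interior points by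
hypothesis, near boundary points because one short tent contains a neighbourhood. Compactness
concludes. The origin is omitted because it lies in no tent. -/
lemma IsVanishingCarleson.measure_lt_top {σ : ℝ} {μ : Measure ℂ} (h : IsVanishingCarleson σ μ)
    (hμ : ∀ K ⊆ disc, IsCompact K → μ K < ⊤) : μ (disc \ {0}) < ∞ := by
  obtain ⟨δ, hδ, hδ2⟩ := h.exists_forall_le one_pos
  have key : (μ.restrict (disc \ {0})) (Metric.closedBall 0 1) < ∞ := by
    refine (isCompact_closedBall (0 : ℂ) 1).measure_lt_top_of_nhdsWithin fun x hx => ?_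
    rw [mem_closedBall_zero_iff] at hx
    rcases hx.lt_or_eq with hx | hx
    · refine ⟨Metric.closedBall x ((1 - ‖x‖) / 2),
        mem_nhdsWithin_of_mem_nhds (Metric.closedBall_mem_nhds x (by linarith)), ?_⟩
      refine (Measure.restrict_apply_le _ _).trans_lt (hμ _ (fun y hy => ?_)
        (isCompact_closedBall _ _))
      rw [Metric.mem_closedBall, dist_eq_norm] at hy
      have := norm_sub_norm_le y x
      rw [mem_ball_zero_iff]
      linarith
    -- Points within η of x are within 2η ≤ 3η of (1-η)x, so they lie in a tent over an arc of
    -- length at most 8η < δ.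
    · set η := min (1 / 2) (δ / 10) with hη
      have hη0 : 0 < η := lt_min (by norm_num) (by positivity)
      have hη1 : η ≤ 1 / 2 := min_le_left _ _
      have hη2 : η ≤ δ / 10 := min_le_right _ _
      have hw : ‖((1 - η : ℝ) : ℂ) * x‖ = 1 - η := by
        rw [norm_mul, hx, mul_one, Complex.norm_real, Real.norm_eq_abs, abs_of_nonneg (by linarith)]
      obtain ⟨J, hJ, hJz⟩ := exists_tent_of_near (w := ((1 - η : ℝ) : ℂ) * x) (by linarith) (A := 3)
        (by norm_num)
      rw [hw, sub_sub_cancel] at hJ hJz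
      refine ⟨Metric.ball x η, mem_nhdsWithin_of_mem_nhds (Metric.ball_mem_nhds x hη0), ?_⟩
      rw [Measure.restrict_apply measurableSet_ball]
      refine (measure_mono (t := tent J) ?_).trans_lt
        ((hδ2 J (by linarith)).trans_lt ENNReal.ofReal_lt_top)
      rintro z ⟨hz, hz1, hz0⟩
      refine hJz z hz0 (mem_ball_zero_iff.1 hz1) ?_
      rw [Metric.mem_ball, dist_eq_norm] at hz
      have e : z - ((1 - η : ℝ) : ℂ) * x = (z - x) + (η : ℂ) * x := by push_cast; ring
      rw [e]
      refine (norm_add_le _ _).trans ?_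
      rw [norm_mul, hx, Complex.norm_real, Real.norm_eq_abs, abs_of_pos hη0]
      linarith
  rw [Measure.restrict_apply measurableSet_closedBall, Set.inter_eq_self_of_subset_right
    (Set.sdiff_subset.trans Metric.ball_subset_closedBall)] at key
  exact key

/-- The part of the disc outside the closed disc of radius `R`. -/
def annulus (R : ℝ) : Set ℂ := {z | R < ‖z‖ ∧ ‖z‖ < 1}

lemma measurableSet_annulus (R : ℝ) : MeasurableSet (annulus R) := by
  have e : annulus R = {z : ℂ | R < ‖z‖} ∩ {z : ℂ | ‖z‖ < 1} := rfl
  rw [e]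
  exact (measurableSet_lt (by fun_prop) (by fun_prop)).inter
    (measurableSet_lt (by fun_prop) (by fun_prop))

lemma annulus_subset_punctured {R : ℝ} (hR : 0 ≤ R) : annulus R ⊆ disc \ {0} := fun _ hz =>
  ⟨mem_ball_zero_iff.2 hz.2, norm_pos_iff.1 (hR.trans_lt hz.1)⟩

lemma exists_measure_annulus_le {μ : Measure ℂ} (hfin : μ (disc \ {0}) < ∞) {κ : ℝ≥0∞}
    (hκ : 0 < κ) : ∃ R : ℝ, 0 ≤ R ∧ R < 1 ∧ μ (annulus R) ≤ κ := by
  set r : ℕ → ℝ := fun n => 1 - 1 / ((n : ℝ) + 1) with hr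
  have hr0 : ∀ n, 0 ≤ r n := fun n => by
    rw [hr]
    have : 1 / ((n : ℝ) + 1) ≤ 1 := by
      rw [div_le_one (by positivity)]
      linarith [n.cast_nonneg (α := ℝ)]
    simp only
    linarith
  have hr1 : ∀ n, r n < 1 := fun n => by
    have : 0 < 1 / ((n : ℝ) + 1) := by positivity
    simp only [hr]
    linarith
  have hanti : Antitone fun n => annulus (r n) := by
    intro m n hmn z hz
    refine ⟨lt_of_le_of_lt ?_ hz.1, hz.2⟩
    have : 1 / ((n : ℝ) + 1) ≤ 1 / ((m : ℝ) + 1) := by gcongr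
    simp only [hr]
    linarith
  have h := tendsto_measure_iInter_atTop (μ := μ)
    (fun n => (measurableSet_annulus (r n)).nullMeasurableSet) hanti
    ⟨0, ((measure_mono (annulus_subset_punctured (hr0 0))).trans_lt hfin).ne⟩
  have he : ⋂ n, annulus (r n) = ∅ := by
    ext z
    simp only [Set.mem_iInter, Set.mem_empty_iff_false, iff_false, not_forall]
    by_contra hcon
    push Not at hcon
    have h1 : Tendsto r atTop (𝓝 (1 - 0)) :=
      tendsto_const_nhds.sub tendsto_one_div_add_atTop_nhds_zero_nat
    have h2 : 1 - 0 ≤ ‖z‖ := le_of_tendsto h1 (Eventually.of_forall fun n => (hcon n).1.le)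
    linarith [(hcon 0).2]
  rw [he, measure_empty] at h
  obtain ⟨n, hn⟩ := (ENNReal.tendsto_nhds_zero.1 h κ hκ).exists
  exact ⟨r n, hr0 n, hr1 n, hn⟩

/-- A measure is Carleson as soon as it is finite and satisfies the Carleson condition on short
arcs. -/
lemma exists_carleson_const {σ : ℝ} (hσ : 0 < σ) {μ : Measure ℂ} (h : IsVanishingCarleson σ μ)
    (hfin : μ (disc \ {0}) < ∞) : ∃ N : ℝ, 0 ≤ N ∧
      ∀ J : Arc, μ (tent J) ≤ ENNReal.ofReal (N * J.length ^ σ) := by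
  obtain ⟨δ, hδ, hδ2⟩ := h.exists_forall_le one_pos
  refine ⟨max 1 ((μ (disc \ {0})).toReal / δ ^ σ), by positivity, fun J => ?_⟩
  have hJ0 := J.length_pos
  rcases lt_or_ge J.length δ with hJ | hJ
  · refine (hδ2 J hJ).trans (ENNReal.ofReal_le_ofReal ?_)
    exact mul_le_mul_of_nonneg_right (le_max_left _ _) (by positivity)
  · refine (measure_mono (tent_subset_punctured J)).trans ?_
    refine (ENNReal.ofReal_toReal hfin.ne).ge.trans (ENNReal.ofReal_le_ofReal ?_)
    have h1 := Real.rpow_le_rpow hδ.le hJ hσ.le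
    have h2 : 0 < δ ^ σ := by positivity
    calc (μ (disc \ {0})).toReal = (μ (disc \ {0})).toReal / δ ^ σ * δ ^ σ := by field_simp
      _ ≤ _ := by
        exact mul_le_mul (le_max_right _ _) h1 h2.le (by positivity)

/-- For a vanishing Carleson measure the Carleson constants of the restrictions to thin annuli at
the boundary are small. -/
lemma exists_annulus_carleson_le {σ : ℝ} (hσ : 0 < σ) {μ : Measure ℂ}
    (h : IsVanishingCarleson σ μ) (hfin : μ (disc \ {0}) < ∞) {ε : ℝ} (hε : 0 < ε) :
    ∃ R : ℝ, 0 ≤ R ∧ R < 1 ∧ ∀ J : Arc,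
      μ.restrict (annulus R) (tent J) ≤ ENNReal.ofReal (ε * J.length ^ σ) := by
  obtain ⟨δ, hδ, hδ2⟩ := h.exists_forall_le hε
  -- Arcs shorter than δ satisfy the bound by assumption. For longer ones the total mass εδ^σ of the
  -- annulus is already at most ε|J|^σ.
  obtain ⟨R, hR0, hR1, hR⟩ := exists_measure_annulus_le hfin (κ := ENNReal.ofReal (ε * δ ^ σ))
    (ENNReal.ofReal_pos.2 (by positivity))
  refine ⟨R, hR0, hR1, fun J => ?_⟩
  rcases lt_or_ge J.length δ with hJ | hJ
  · exact (Measure.restrict_apply_le _ _).trans (hδ2 J hJ)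
  · have h1 := Real.rpow_le_rpow hδ.le hJ hσ.le
    calc _ ≤ μ.restrict (annulus R) Set.univ := measure_mono (Set.subset_univ _)
      _ = μ (annulus R) := by simp
      _ ≤ _ := hR.trans (ENNReal.ofReal_le_ofReal (by gcongr))

/-! ### Sufficiency: vanishing Carleson measures give compactness. -/

lemma tENorm_le_of_forall {p s : ℝ} (hp : 0 < p) {μ : Measure ℂ} {f : ℂ → ℂ} {K : ℝ≥0∞}
    (h : ∀ I : Arc, (∫⁻ z in tent I, ‖f z‖ₑ ^ p ∂μ) / ENNReal.ofReal (I.length ^ s) ≤ K) :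
    tENorm p s μ f ≤ K ^ (1 / p) :=
  iSup_le fun I => ENNReal.rpow_le_rpow (h I) (by positivity)

lemma ofReal_length_rpow_ne_zero (I : Arc) (s : ℝ) : ENNReal.ofReal (I.length ^ s) ≠ 0 :=
  (ENNReal.ofReal_pos.2 (Real.rpow_pos_of_pos I.length_pos s)).ne'

/-- A bounded sequence of `F(p, pα - 2, t)` that tends to zero pointwise tends to zero in the tent
space of a vanishing Carleson measure. -/
lemma tendsto_tENorm_zero {α p s t : ℝ} (hα : 1 < α) (hp : 1 < p) (ht : 0 < t) (hts : t < s)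
    {μ : Measure ℂ} (hμ : ∀ K ⊆ disc, IsCompact K → μ K < ⊤)
    (h : IsVanishingCarleson (s + p * (α - 1)) μ) {M : ℝ} {g : ℕ → ℂ → ℂ}
    (hg : ∀ n, FBound p (p * α - 2) t M (g n))
    (hg0 : ∀ z ∈ disc, Tendsto (fun n => g n z) atTop (𝓝 0)) :
    Tendsto (fun n => tENorm p s μ (g n)) atTop (𝓝 0) := by
  obtain ⟨C, hC, hmain⟩ := FBound.lintegral_tent_le hα hp ht hts
  obtain ⟨C₁, hC₁, hgrow⟩ := FBound.norm_le hp hα ht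
  have hp0 : 0 < p := by linarith
  have hs0 : 0 < s := by linarith
  have hM := (hg 0).nonneg
  have hσ0 : 0 < s + p * (α - 1) := by
    have : 0 < p * (α - 1) := mul_pos hp0 (by linarith)
    linarith
  have hfin := h.measure_lt_top hμ
  set U : ℕ → ℝ≥0∞ := fun n => ⨆ I : Arc,
    (∫⁻ z in tent I, ‖g n z‖ₑ ^ p ∂μ) / ENNReal.ofReal (I.length ^ s) with hU
  suffices hU0 : Tendsto U atTop (𝓝 0) by
    have h1 := ((ENNReal.continuous_rpow_const (y := 1 / p)).tendsto 0).comp hU0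
    rw [ENNReal.zero_rpow_of_pos (by positivity)] at h1
    exact tendsto_of_tendsto_of_tendsto_of_le_of_le tendsto_const_nhds h1 (fun _ => zero_le)
      fun n => tENorm_le_of_forall hp0 fun I => le_iSup (fun I : Arc =>
        (∫⁻ z in tent I, ‖g n z‖ₑ ^ p ∂μ) / ENNReal.ofReal (I.length ^ s)) I
  rw [ENNReal.tendsto_nhds_zero]
  intro ε hε
  obtain ⟨x, hx0, hxε⟩ := ENNReal.lt_iff_exists_nnreal_btwn.1 hε
  have hx0' : (0 : ℝ) < x := by exact_mod_cast hx0
  set κ : ℝ := x / 2 with hκ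
  have hκ0 : 0 < κ := by positivity
  -- With this Carleson constant the embedding bounds the annular part by κ|I|^s, where κ is half
  -- the target; the summand 1 keeps the denominator positive when M = 0.
  obtain ⟨R, hR0, hR1, hR⟩ := exists_annulus_carleson_le hσ0 h hfin
    (ε := κ / (C * (M ^ p + 1))) (by positivity)
  have hd : 0 < 1 - R := by linarith
  have : IsFiniteMeasure (μ.restrict (annulus R)) := ⟨by
    rw [Measure.restrict_apply_univ]
    exact (measure_mono (annulus_subset_punctured hR0)).trans_lt hfin⟩
  have hsub : Metric.closedBall (0 : ℂ) R ⊆ disc := Metric.closedBall_subset_ball hR1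
  have : IsFiniteMeasure (μ.restrict (Metric.closedBall 0 R)) := ⟨by
    rw [Measure.restrict_apply_univ]
    exact hμ _ hsub (isCompact_closedBall _ _)⟩
  have hA : Tendsto (fun n => ∫⁻ z in Metric.closedBall 0 R, ‖g n z‖ₑ ^ p ∂μ) atTop (𝓝 0) := by
    have hlim := tendsto_lintegral_of_dominated_convergence' (μ := μ.restrict (Metric.closedBall 0 R))
      (F := fun n z => ‖g n z‖ₑ ^ p) (f := fun _ => 0)
      (fun _ => ENNReal.ofReal ((C₁ * M * (1 - R) ^ (1 - α)) ^ p))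
      (fun n => (((hg n).diff.continuousOn.mono hsub).aemeasurable
        measurableSet_closedBall).enorm.pow_const p)
      (fun n => (ae_restrict_iff' measurableSet_closedBall).2 (Eventually.of_forall fun z hz => by
        simp only [enorm_rpow_eq_ofReal _ hp0.le]
        apply ENNReal.ofReal_le_ofReal
        rw [mem_closedBall_zero_iff] at hz
        refine Real.rpow_le_rpow (norm_nonneg _)
          ((hgrow (hg n) (by linarith)).trans ?_) hp0.le
        have := Real.rpow_le_rpow_of_nonpos (z := 1 - α) hd (by linarith : 1 - R ≤ 1 - ‖z‖)
          (by linarith)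
        gcongr))
      (by
        rw [lintegral_const]
        exact ENNReal.mul_ne_top ENNReal.ofReal_ne_top (measure_ne_top _ _))
      ((ae_restrict_iff' measurableSet_closedBall).2 (Eventually.of_forall fun z hz => by
        have h1 := ((ENNReal.continuous_rpow_const (y := p)).tendsto _).comp
          (hg0 z (hsub hz)).enorm
        rwa [enorm_zero, ENNReal.zero_rpow_of_pos hp0] at h1))
    rwa [lintegral_zero] at hlim
  have hb : 0 < κ * (1 - R) ^ s := by positivity
  filter_upwards [ENNReal.tendsto_nhds_zero.1 hA (ENNReal.ofReal (κ * (1 - R) ^ s))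
    (ENNReal.ofReal_pos.2 hb)] with n hn
  refine iSup_le fun I => le_trans ?_ hxε.le
  have hI0 := I.length_pos
  rw [ENNReal.div_le_iff (ofReal_length_rpow_ne_zero I s) ENNReal.ofReal_ne_top]
  have h1 : ∫⁻ z in tent I ∩ Metric.closedBall 0 R, ‖g n z‖ₑ ^ p ∂μ ≤
      ENNReal.ofReal (κ * I.length ^ s) := by
    rcases (tent I ∩ Metric.closedBall 0 R).eq_empty_or_nonempty with he | ⟨z, hz1, hz2⟩
    · rw [he]; simp
    · rw [mem_closedBall_zero_iff] at hz2
      -- Only arcs of length at least 1-R have tents meeting the inner disc, so one bound on the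
      -- integral over that disc serves all arcs at once.
      have hl : 1 - R ≤ I.length := by linarith [hz1.1]
      refine (lintegral_mono_set Set.inter_subset_right).trans (hn.trans ?_)
      apply ENNReal.ofReal_le_ofReal
      gcongr
  have h2 : ∫⁻ z in tent I \ Metric.closedBall 0 R, ‖g n z‖ₑ ^ p ∂μ ≤
      ENNReal.ofReal (κ * I.length ^ s) := by
    have hset : tent I \ Metric.closedBall 0 R ⊆ tent I ∩ annulus R := by
      rintro z ⟨hz1, hz2⟩
      rw [mem_closedBall_zero_iff, not_le] at hz2
      exact ⟨hz1, hz2, hz1.2.1⟩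
    refine (lintegral_mono_set hset).trans ?_
    rw [← Measure.restrict_restrict (measurableSet_tent I)]
    refine (hmain (by positivity) hR (hg n) I).trans (ENNReal.ofReal_le_ofReal ?_)
    have e : C * (κ / (C * (M ^ p + 1))) * M ^ p * I.length ^ s =
        κ * I.length ^ s * (M ^ p / (M ^ p + 1)) := by
      field_simp
    rw [e]
    refine mul_le_of_le_one_right (by positivity) ?_
    rw [div_le_one (by positivity)]
    linarith
  rw [← lintegral_inter_add_sdiff _ (tent I) (measurableSet_closedBall (x := (0 : ℂ)) (ε := R))]
  refine (add_le_add h1 h2).trans (le_of_eq ?_)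
  rw [← ENNReal.ofReal_add (by positivity) (by positivity), ← ENNReal.ofReal_coe_nnreal,
    ← ENNReal.ofReal_mul x.coe_nonneg]
  congr 1
  rw [hκ]
  ring

lemma fSubmodule_le_tSubmodule {α p s t : ℝ} (hα : 1 < α) (hp : 1 < p) (ht : 0 < t) (hts : t < s)
    {μ : Measure ℂ} (hμ : ∀ K ⊆ disc, IsCompact K → μ K < ⊤)
    (h : IsVanishingCarleson (s + p * (α - 1)) μ) :
    fSubmodule p (p * α - 2) t hp.le ≤ tSubmodule p s μ hp.le := by
  obtain ⟨C, hC, hmain⟩ := FBound.lintegral_tent_le hα hp ht hts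
  have hp0 : 0 < p := by linarith
  have hσ0 : 0 < s + p * (α - 1) := by
    have : 0 < p * (α - 1) := mul_pos hp0 (by linarith)
    linarith
  have hfin := h.measure_lt_top hμ
  obtain ⟨N, hN, hNJ⟩ := exists_carleson_const hσ0 h hfin
  -- Nothing is assumed about μ off the disc. The restriction is finite, as Tonelli's theorem needs,
  -- and has the same values on tents.
  have : IsFiniteMeasure (μ.restrict (disc \ {0})) := ⟨by rwa [Measure.restrict_apply_univ]⟩
  rintro f ⟨hf, hfn⟩
  refine ⟨hf, ?_⟩
  set M := (fENorm p (p * α - 2) t f).toReal with hM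
  have hM0 : 0 ≤ M := ENNReal.toReal_nonneg
  have hB : FBound p (p * α - 2) t M f := FBound.of_fENorm_le hp0 hM0 hf
    (by rw [hM, ENNReal.ofReal_toReal hfn.ne])
  refine (tENorm_le_of_forall hp0 (K := ENNReal.ofReal (C * N * M ^ p)) fun I => ?_).trans_lt
    (ENNReal.rpow_lt_top_of_nonneg (by positivity) ENNReal.ofReal_ne_top)
  rw [ENNReal.div_le_iff (ofReal_length_rpow_ne_zero I s) ENNReal.ofReal_ne_top,
    ← ENNReal.ofReal_mul (by positivity)]
  have h1 := hmain (ν := μ.restrict (disc \ {0})) hN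
    (fun J => (Measure.restrict_apply_le _ _).trans (hNJ J)) hB I
  rwa [Measure.restrict_restrict (measurableSet_tent I),
    Set.inter_eq_self_of_subset_left (tent_subset_punctured I)] at h1

/-- The image of the set `FBound` with M = 1 is itself compact: pointwise limits stay in that set,
and pointwise convergence of a bounded sequence implies tent-norm convergence. The set contains the
open unit ball. -/
lemma idIsCompact_of_isVanishingCarleson {α p s t : ℝ} (hα : 1 < α) (hp : 1 < p) (ht : 0 < t)
    (hts : t < s) {μ : Measure ℂ} (hμ : ∀ K ⊆ disc, IsCompact K → μ K < ⊤)
    (h : IsVanishingCarleson (s + p * (α - 1)) μ) : IdIsCompact p (p * α - 2) t s μ hp.le := by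
  have hp0 : 0 < p := by linarith
  have hle := fSubmodule_le_tSubmodule hα hp ht hts hμ h
  refine ⟨hle, idMap hle '' {f | FBound p (p * α - 2) t 1 f.1}, ?_, ?_⟩
  · refine IsSeqCompact.isCompact fun x hx => ?_
    choose F hF hFx using hx
    obtain ⟨φ, f, hφ, hf, hlim⟩ := FBound.exists_subseq hp hα ht hF
    set f' : FSpace p (p * α - 2) t hp.le :=
      ⟨f, hf.diff, (hf.fENorm_le hp0).trans_lt ENNReal.ofReal_lt_top⟩ with hf'
    refine ⟨idMap hle f', ⟨f', hf, rfl⟩, φ, hφ, ?_⟩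
    rw [tendsto_iff_norm_sub_tendsto_zero]
    have h0 := tendsto_tENorm_zero hα hp ht hts hμ h
      (g := fun n => (F (φ n)).1 - f) (fun n => (hF (φ n)).sub hp.le hf)
      (fun z hz => by simpa using (hlim z hz).sub_const (f z))
    have h1 := (ENNReal.tendsto_toReal ENNReal.zero_ne_top).comp h0
    rw [ENNReal.toReal_zero] at h1
    refine h1.congr fun n => ?_
    rw [Function.comp_apply, Function.comp_apply, ← hFx]
    rfl
  · refine mem_of_superset (Metric.ball_mem_nhds 0 one_pos) fun f hf => ?_
    refine ⟨f, ?_, rfl⟩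
    rw [mem_ball_zero_iff] at hf
    change (fENorm p (p * α - 2) t f.1).toReal < 1 at hf
    refine FBound.of_fENorm_le hp0 zero_le_one f.2.1 ?_
    rw [← ENNReal.ofReal_toReal f.2.2.ne]
    exact ENNReal.ofReal_le_ofReal hf.le

/-! ### The Forelli-Rudin estimate. -/

lemma lintegral_Ioi_rpow {c h : ℝ} (hc : 0 < c) (hh : 0 < h) :
    ∫⁻ x in Set.Ioi h, ENNReal.ofReal (x ^ (-1 - c)) = ENNReal.ofReal (h ^ (-c) / c) := by
  rw [← ofReal_integral_eq_lintegral_ofReal (integrableOn_Ioi_rpow_of_lt (by linarith) hh)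
      ((ae_restrict_iff' measurableSet_Ioi).2 (Eventually.of_forall fun x hx =>
        Real.rpow_nonneg (hh.trans hx).le _)), integral_Ioi_rpow_of_lt (by linarith) hh]
  congr 1
  rw [show -1 - c + 1 = -c by ring]
  field_simp

/-- Split at x = h: below, h + x is replaced by h and q > -1 gives integrability at 0; above, it is
replaced by x and c > 0 gives integrability at infinity. -/
lemma lintegral_rpow_mul_add_rpow_le {q c h : ℝ} (hq : -1 < q) (hc : 0 < c) (hh : 0 < h) :
    ∫⁻ x in Set.Ioi 0, ENNReal.ofReal (x ^ q * (h + x) ^ (-(1 + q + c))) ≤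
      ENNReal.ofReal ((1 / (q + 1) + 1 / c) * h ^ (-c)) := by
  have hq1 : 0 < q + 1 := by linarith
  rw [← Set.Ioc_union_Ioi_eq_Ioi hh.le]
  refine (lintegral_union_le _ _ _).trans ?_
  have h1 : ∫⁻ x in Set.Ioc 0 h, ENNReal.ofReal (x ^ q * (h + x) ^ (-(1 + q + c))) ≤
      ENNReal.ofReal (1 / (q + 1) * h ^ (-c)) := by
    calc _ ≤ ∫⁻ x in Set.Ioc 0 h, ENNReal.ofReal (h ^ (-(1 + q + c))) * ENNReal.ofReal (x ^ q) := by
          refine setLIntegral_mono' measurableSet_Ioc fun x hx => ?_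
          rw [← ENNReal.ofReal_mul (by positivity), mul_comm]
          apply ENNReal.ofReal_le_ofReal
          have := Real.rpow_le_rpow_of_nonpos (z := -(1 + q + c)) hh
            (by linarith [hx.1] : h ≤ h + x) (by linarith)
          have h2 : 0 ≤ x ^ q := Real.rpow_nonneg hx.1.le _
          gcongr
      _ = _ := by
          rw [lintegral_const_mul' _ _ ENNReal.ofReal_ne_top, lintegral_rpow_zero_le hq hh.le,
            ← ENNReal.ofReal_mul (by positivity), mul_div_assoc', ← Real.rpow_add hh,
            show -(1 + q + c) + (q + 1) = -c by ring]
          congr 1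
          ring
  have h2 : ∫⁻ x in Set.Ioi h, ENNReal.ofReal (x ^ q * (h + x) ^ (-(1 + q + c))) ≤
      ENNReal.ofReal (1 / c * h ^ (-c)) := by
    rw [one_div_mul_eq_div, ← lintegral_Ioi_rpow hc hh]
    refine setLIntegral_mono' measurableSet_Ioi fun x hx => ENNReal.ofReal_le_ofReal ?_
    have hx0 : 0 < x := hh.trans hx
    have := Real.rpow_le_rpow_of_nonpos (z := -(1 + q + c)) hx0
      (by linarith : x ≤ h + x) (by linarith)
    calc x ^ q * (h + x) ^ (-(1 + q + c)) ≤ x ^ q * x ^ (-(1 + q + c)) := by gcongr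
      _ = _ := by
        rw [← Real.rpow_add hx0]
        congr 1
        ring
  refine (add_le_add h1 h2).trans (le_of_eq ?_)
  rw [← ENNReal.ofReal_add (by positivity) (by positivity), ← add_mul]

lemma lintegral_add_abs_rpow_le {c h : ℝ} (hc : 0 < c) (hh : 0 < h) :
    ∫⁻ θ : ℝ, ENNReal.ofReal ((h + |θ|) ^ (-(1 + c))) ≤
      ENNReal.ofReal (2 * (1 + 1 / c) * h ^ (-c)) := by
  have h1 : ∫⁻ θ in Set.Ioi 0, ENNReal.ofReal ((h + |θ|) ^ (-(1 + c))) ≤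
      ENNReal.ofReal ((1 + 1 / c) * h ^ (-c)) := by
    have h0 := lintegral_rpow_mul_add_rpow_le (q := 0) (by norm_num) hc hh
    simp only [Real.rpow_zero, one_mul, add_zero, zero_add, div_one] at h0
    refine le_trans (le_of_eq ?_) h0
    refine setLIntegral_congr_fun measurableSet_Ioi fun θ hθ => ?_
    simp only [abs_of_pos (Set.mem_Ioi.1 hθ)]
  have h2 : ∫⁻ θ in Set.Iic 0, ENNReal.ofReal ((h + |θ|) ^ (-(1 + c))) ≤
      ENNReal.ofReal ((1 + 1 / c) * h ^ (-c)) := by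
    refine le_trans (le_of_eq ?_) h1
    rw [setLIntegral_congr Iio_ae_eq_Iic.symm, ← lintegral_indicator measurableSet_Iio,
      ← lintegral_indicator measurableSet_Ioi, ← lintegral_neg_eq_self]
    refine lintegral_congr fun θ => ?_
    simp only [Set.indicator_apply, Set.mem_Iio, Set.mem_Ioi, abs_neg, neg_lt_zero]
  rw [← lintegral_add_compl _ (measurableSet_Iic (a := (0 : ℝ))), Set.compl_Iic]
  refine (add_le_add h2 h1).trans (le_of_eq ?_)
  rw [← ENNReal.ofReal_add (by positivity) (by positivity)]
  congr 1
  ring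

/-- The denominator D dominates 1-ρ with ρ = (1-h)r, hence both h and 1-r. Moreover |θ| ≤
(π/2)|1-e^(iθ)| ≤ (π/2)(D + 1-ρ) ≤ πD, so 1 + π < 5 is an admissible constant. -/
lemma add_le_norm_one_sub {h r : ℝ} (hh : 0 < h) (h1 : h ≤ 1) (hr0 : 0 ≤ r) (hr1 : r < 1) {θ : ℝ}
    (hθ : θ ∈ Set.Ioo (-Real.pi) Real.pi) :
    h + (1 - r) ≤ 2 * ‖1 - ((1 - h : ℝ) : ℂ) * circleMap 0 r θ‖ ∧
      h + |θ| ≤ 5 * ‖1 - ((1 - h : ℝ) : ℂ) * circleMap 0 r θ‖ := by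
  set ρ := (1 - h) * r with hρ
  have hρ0 : 0 ≤ ρ := mul_nonneg (by linarith) hr0
  have hρ1 : h ≤ 1 - ρ := by nlinarith
  have hρ2 : 1 - r ≤ 1 - ρ := by nlinarith
  have e : ((1 - h : ℝ) : ℂ) * circleMap 0 r θ = (ρ : ℂ) * Complex.exp (θ * Complex.I) := by
    rw [circleMap_zero, hρ]; push_cast; ring
  rw [e]
  have hE : ‖Complex.exp (θ * Complex.I)‖ = 1 := Complex.norm_exp_ofReal_mul_I θ
  have hlow : 1 - ρ ≤ ‖1 - (ρ : ℂ) * Complex.exp (θ * Complex.I)‖ := by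
    have := norm_sub_norm_le (1 : ℂ) ((ρ : ℂ) * Complex.exp (θ * Complex.I))
    rwa [norm_one, norm_mul, hE, mul_one, Complex.norm_real, Real.norm_eq_abs,
      abs_of_nonneg hρ0] at this
  refine ⟨by linarith, ?_⟩
  have h2 : ‖1 - Complex.exp (θ * Complex.I)‖ ≤
      ‖1 - (ρ : ℂ) * Complex.exp (θ * Complex.I)‖ + (1 - ρ) := by
    have e2 : 1 - Complex.exp (θ * Complex.I) = (1 - (ρ : ℂ) * Complex.exp (θ * Complex.I)) -
        ((1 - ρ : ℝ) : ℂ) * Complex.exp (θ * Complex.I) := by push_cast; ring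
    rw [e2]
    refine (norm_sub_le _ _).trans ?_
    rw [norm_mul ((1 - ρ : ℝ) : ℂ), hE, mul_one, Complex.norm_real, Real.norm_eq_abs,
      abs_of_nonneg (by linarith)]
  have h3 := Complex.angle_le_mul_norm_sub hE (norm_one (α := ℂ))
  rw [Complex.angle_one_right (Complex.exp_ne_zero _), Complex.arg_exp_mul_I,
    (toIocMod_eq_self _).2 ⟨hθ.1, by linarith [hθ.2]⟩, norm_sub_rev] at h3
  nlinarith [Real.pi_lt_d2, Real.pi_gt_three, norm_nonneg (1 - Complex.exp (θ * Complex.I))]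

/-- The Forelli-Rudin estimate, upper bound, for a point on the real radius. -/
lemma lintegral_forelliRudin_real_le {q c : ℝ} (hq : -1 < q) (hc : 0 < c) :
    ∃ C : ℝ, 0 < C ∧ ∀ {h : ℝ} (_ : 0 < h) (_ : h ≤ 1),
    ∫⁻ z in disc, ENNReal.ofReal ((1 - ‖z‖ ^ 2) ^ q *
      ‖1 - ((1 - h : ℝ) : ℂ) * z‖ ^ (-(2 + q + c))) ≤ ENNReal.ofReal (C * h ^ (-c)) := by
  have hq1 : 0 < q + 1 := by linarith
  -- The exponent 2 + q + c is split as m₁ + m₂. The factor with m₁ is used in the radius and that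
  -- with m₂ in the angle, so that the variables separate and each integral contributes h^(-c/2).
  set m₁ := 1 + q + c / 2 with hm₁
  set m₂ := 1 + c / 2 with hm₂
  have hm₁0 : 0 < m₁ := by linarith
  set A : ℝ := 2 ^ |q| * 2 ^ m₁ * 5 ^ m₂ with hA
  set C₁ := 1 / (q + 1) + 1 / (c / 2) with hC₁
  set C₂ := 2 * (1 + 1 / (c / 2)) with hC₂
  refine ⟨A * C₁ * C₂, by positivity, fun {h} hh h1 => ?_⟩
  have key : ∀ r ∈ Set.Ioo (0 : ℝ) 1, ∀ θ ∈ Set.Ioo (-Real.pi) Real.pi,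
      r * ((1 - r ^ 2) ^ q * ‖1 - ((1 - h : ℝ) : ℂ) * circleMap 0 r θ‖ ^ (-(2 + q + c))) ≤
        A * ((1 - r) ^ q * (h + (1 - r)) ^ (-m₁)) * (h + |θ|) ^ (-m₂) := by
    rintro r ⟨hr0, hr1⟩ θ hθ
    obtain ⟨b1, b2⟩ := add_le_norm_one_sub hh h1 hr0.le hr1 hθ
    set D := ‖1 - ((1 - h : ℝ) : ℂ) * circleMap 0 r θ‖ with hD
    have hr : 0 < 1 - r := by linarith
    have hD0 : 0 < D := by linarith
    have e1 : D ^ (-(2 + q + c)) = D ^ (-m₁) * D ^ (-m₂) := by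
      rw [← Real.rpow_add hD0]
      congr 1
      rw [hm₁, hm₂]; ring
    have e2 : ∀ {m K y : ℝ}, 0 < m → 0 < K → 0 < y → y ≤ K * D →
        D ^ (-m) ≤ K ^ m * y ^ (-m) := by
      intro m K y hm hK hy hyD
      have := Real.rpow_le_rpow_of_nonpos hy hyD (neg_nonpos.2 hm.le)
      rw [Real.mul_rpow hK.le hD0.le] at this
      calc D ^ (-m) = K ^ m * (K ^ (-m) * D ^ (-m)) := by
            rw [← mul_assoc, ← Real.rpow_add hK]; simp
        _ ≤ _ := by gcongr
    have e3 := e2 (m := m₁) hm₁0 two_pos (by positivity) b1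
    have e4 := e2 (m := m₂) (by positivity) (by norm_num) (by positivity) b2
    have e5 : (1 - r ^ 2) ^ q ≤ 2 ^ |q| * (1 - r) ^ q :=
      rpow_le_of_comparable (by nlinarith) hr one_le_two (by nlinarith) (by nlinarith) q
    have hr2 : 0 ≤ (1 - r ^ 2) ^ q := Real.rpow_nonneg (by nlinarith) _
    calc r * ((1 - r ^ 2) ^ q * D ^ (-(2 + q + c)))
        ≤ 1 * ((2 ^ |q| * (1 - r) ^ q) *
          ((2 ^ m₁ * (h + (1 - r)) ^ (-m₁)) * (5 ^ m₂ * (h + |θ|) ^ (-m₂)))) := by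
          rw [e1]; gcongr
      _ = _ := by rw [hA]; ring
  have hmeas : Measurable fun z : ℂ => ENNReal.ofReal ((1 - ‖z‖ ^ 2) ^ q *
      ‖1 - ((1 - h : ℝ) : ℂ) * z‖ ^ (-(2 + q + c))) := by fun_prop
  rw [← lintegral_indicator measurableSet_ball, lintegral_polar (hmeas.indicator measurableSet_ball)]
  have hrad : ∫⁻ r in Set.Ioo 0 1, ENNReal.ofReal (A * ((1 - r) ^ q * (h + (1 - r)) ^ (-m₁))) ≤
      ENNReal.ofReal (A * (C₁ * h ^ (-(c / 2)))) := by
    have h2 : ∫⁻ r in Set.Ioo 0 1, ENNReal.ofReal ((1 - r) ^ q * (h + (1 - r)) ^ (-m₁)) ≤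
        ENNReal.ofReal (C₁ * h ^ (-(c / 2))) := by
      refine le_trans ?_ (lintegral_rpow_mul_add_rpow_le hq (half_pos hc) hh)
      rw [← lintegral_indicator measurableSet_Ioi, ← lintegral_indicator measurableSet_Ioo,
        ← lintegral_sub_left_eq_self _ (1 : ℝ)]
      refine lintegral_mono fun x => ?_
      by_cases hx : 1 - x ∈ Set.Ioo (0 : ℝ) 1
      · rw [Set.indicator_of_mem hx, Set.indicator_of_mem (by
          have := hx.2
          rw [Set.mem_Ioi]; linarith), sub_sub_cancel]
      · rw [Set.indicator_of_notMem hx]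
        exact zero_le
    have hA0 : 0 ≤ A := by positivity
    simp only [ENNReal.ofReal_mul hA0]
    rw [lintegral_const_mul' _ _ ENNReal.ofReal_ne_top]
    gcongr
  have hang : ∫⁻ θ in Set.Ioo (-Real.pi) Real.pi, ENNReal.ofReal ((h + |θ|) ^ (-m₂)) ≤
      ENNReal.ofReal (C₂ * h ^ (-(c / 2))) :=
    (setLIntegral_le_lintegral _ _).trans (lintegral_add_abs_rpow_le (half_pos hc) hh)
  calc _ ≤ ∫⁻ r in Set.Ioi (0 : ℝ), (Set.Ioo (0 : ℝ) 1).indicator (fun r =>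
          ENNReal.ofReal (A * ((1 - r) ^ q * (h + (1 - r)) ^ (-m₁))) *
            ENNReal.ofReal (C₂ * h ^ (-(c / 2)))) r := by
        refine setLIntegral_mono' measurableSet_Ioi fun r hr => ?_
        rw [Set.mem_Ioi] at hr
        have hnr : ∀ θ, ‖circleMap 0 r θ‖ = r := fun θ => by
          rw [norm_circleMap_zero, abs_of_pos hr]
        by_cases hr1 : r < 1
        · have hr' : 0 < 1 - r := by linarith
          rw [Set.indicator_of_mem (show r ∈ Set.Ioo (0 : ℝ) 1 from ⟨hr, hr1⟩)]
          refine le_trans ?_ (mul_le_mul' le_rfl hang)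
          rw [← lintegral_const_mul' _ _ ENNReal.ofReal_ne_top,
            ← lintegral_const_mul' _ _ ENNReal.ofReal_ne_top]
          refine setLIntegral_mono' measurableSet_Ioo fun θ hθ => ?_
          rw [Set.indicator_of_mem (by rw [mem_ball_zero_iff, hnr]; exact hr1),
            ← ENNReal.ofReal_mul hr.le, ← ENNReal.ofReal_mul (by positivity), hnr]
          exact ENNReal.ofReal_le_ofReal (key r ⟨hr, hr1⟩ θ hθ)
        · have h0 : ∀ θ, (disc).indicator (fun z : ℂ => ENNReal.ofReal ((1 - ‖z‖ ^ 2) ^ q *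
              ‖1 - ((1 - h : ℝ) : ℂ) * z‖ ^ (-(2 + q + c)))) (circleMap 0 r θ) = 0 := fun θ =>
            Set.indicator_of_notMem (by rw [mem_ball_zero_iff, hnr]; exact hr1) _
          simp only [h0, lintegral_zero, mul_zero, zero_le]
    _ = (∫⁻ r in Set.Ioo 0 1, ENNReal.ofReal (A * ((1 - r) ^ q * (h + (1 - r)) ^ (-m₁)))) *
          ENNReal.ofReal (C₂ * h ^ (-(c / 2))) := by
        rw [setLIntegral_indicator measurableSet_Ioo,
          Set.inter_eq_self_of_subset_left Set.Ioo_subset_Ioi_self,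
          lintegral_mul_const' _ _ ENNReal.ofReal_ne_top]
    _ ≤ ENNReal.ofReal (A * (C₁ * h ^ (-(c / 2)))) * ENNReal.ofReal (C₂ * h ^ (-(c / 2))) := by
        gcongr
    _ = _ := by
        rw [← ENNReal.ofReal_mul (by positivity)]
        congr 1
        have : h ^ (-c) = h ^ (-(c / 2)) * h ^ (-(c / 2)) := by
          rw [← Real.rpow_add hh]
          congr 1
          ring
        rw [this]
        ring

/-- The Forelli-Rudin estimate, upper bound, at the point `(1 - h) η`. -/
lemma lintegral_forelliRudin_le {q c : ℝ} (hq : -1 < q) (hc : 0 < c) :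
    ∃ C : ℝ, 0 < C ∧ ∀ {h : ℝ} (_ : 0 < h) (_ : h ≤ 1) {η : ℂ} (_ : ‖η‖ = 1),
    ∫⁻ z in disc, ENNReal.ofReal ((1 - ‖z‖ ^ 2) ^ q *
      ‖1 - (starRingEnd ℂ) (((1 - h : ℝ) : ℂ) * η) * z‖ ^ (-(2 + q + c))) ≤
        ENNReal.ofReal (C * h ^ (-c)) := by
  obtain ⟨C, hC, hreal⟩ := lintegral_forelliRudin_real_le hq hc
  refine ⟨C, hC, fun {h} hh h1 {η} hη => le_trans (le_of_eq ?_) (hreal hh h1)⟩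
  -- Rotation by η preserves area and the modulus, and moves the point (1-h)η to the real radius.
  set e := rotation ⟨η, by simpa [Submonoid.unitSphere] using hη⟩ with he
  have hval : ∀ u, e u = η * u := fun u => rotation_apply _ _
  rw [← lintegral_indicator measurableSet_ball, ← lintegral_indicator measurableSet_ball,
    ← e.measurePreserving.lintegral_comp_emb e.toHomeomorph.measurableEmbedding]
  refine lintegral_congr fun u => ?_
  have hn : ‖e u‖ = ‖u‖ := e.norm_map u
  have hc : (starRingEnd ℂ) η * η = 1 := by
    rw [mul_comm, Complex.mul_conj, Complex.normSq_eq_norm_sq, hη]; simp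
  have h2 : (starRingEnd ℂ) (((1 - h : ℝ) : ℂ) * η) * e u = ((1 - h : ℝ) : ℂ) * u := by
    rw [hval, map_mul, Complex.conj_ofReal]
    linear_combination ((1 - h : ℝ) : ℂ) * u * hc
  have hmem : e u ∈ disc ↔ u ∈ disc := by rw [mem_ball_zero_iff, mem_ball_zero_iff, hn]
  by_cases hu : u ∈ disc
  · rw [Set.indicator_of_mem hu, Set.indicator_of_mem (hmem.2 hu), hn, h2]
  · rw [Set.indicator_of_notMem hu, Set.indicator_of_notMem (mt hmem.1 hu)]

/-! ### Test functions concentrated on tents. -/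

/-- The test function `κ h^{N + 1 - α} / (1 - conj a z)^N` with `a = (1 - h) η`. -/
noncomputable def testFn (κ α : ℝ) (N : ℕ) (h : ℝ) (η z : ℂ) : ℂ :=
  ((κ * h ^ ((N : ℝ) + 1 - α) : ℝ) : ℂ) *
    ((1 - (starRingEnd ℂ) (((1 - h : ℝ) : ℂ) * η) * z) ^ N)⁻¹

lemma norm_testPoint {h : ℝ} (h1 : h ≤ 1) {η : ℂ} (hη : ‖η‖ = 1) :
    ‖((1 - h : ℝ) : ℂ) * η‖ = 1 - h := by
  rw [norm_mul, hη, mul_one, Complex.norm_real, Real.norm_eq_abs, abs_of_nonneg (by linarith)]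

lemma testFn_denom_ne_zero {h : ℝ} (h0 : 0 < h) (h1 : h ≤ 1) {η : ℂ} (hη : ‖η‖ = 1) {z : ℂ}
    (hz : ‖z‖ < 1) : 1 - (starRingEnd ℂ) (((1 - h : ℝ) : ℂ) * η) * z ≠ 0 :=
  norm_pos_iff.1 (norm_one_sub_conj_mul_pos (by rw [norm_testPoint h1 hη]; linarith) hz)

lemma hasDerivAt_testFn (κ α : ℝ) (N : ℕ) {h : ℝ} (h0 : 0 < h) (h1 : h ≤ 1) {η : ℂ}
    (hη : ‖η‖ = 1) {z : ℂ} (hz : ‖z‖ < 1) :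
    HasDerivAt (testFn κ α N h η) (((κ * h ^ ((N : ℝ) + 1 - α) : ℝ) : ℂ) *
      (N * (starRingEnd ℂ) (((1 - h : ℝ) : ℂ) * η) *
        ((1 - (starRingEnd ℂ) (((1 - h : ℝ) : ℂ) * η) * z) ^ (N + 1))⁻¹)) z := by
  set a := (starRingEnd ℂ) (((1 - h : ℝ) : ℂ) * η) with ha
  have hne : 1 - a * z ≠ 0 := testFn_denom_ne_zero h0 h1 hη hz
  have hlin : HasDerivAt (fun w : ℂ => 1 - a * w) (-a) z := by
    simpa using ((hasDerivAt_id z).const_mul a).const_sub 1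
  have hpow := (hlin.fun_pow N).fun_inv (pow_ne_zero N hne)
  refine (hpow.const_mul _).congr_deriv ?_
  congr 1
  rcases N with _ | n
  · simp
  · rw [Nat.add_sub_cancel]
    field_simp
    ring

lemma norm_testFn {κ α : ℝ} (hκ : 0 ≤ κ) (N : ℕ) {h : ℝ} (h0 : 0 < h) (η z : ℂ) :
    ‖testFn κ α N h η z‖ = κ * h ^ ((N : ℝ) + 1 - α) *
      (‖1 - (starRingEnd ℂ) (((1 - h : ℝ) : ℂ) * η) * z‖ ^ N)⁻¹ := by
  rw [testFn, norm_mul, norm_inv, norm_pow, Complex.norm_real, Real.norm_eq_abs,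
    abs_of_nonneg (by positivity)]

lemma norm_deriv_testFn_le {κ α : ℝ} (hκ : 0 ≤ κ) (N : ℕ) {h : ℝ} (h0 : 0 < h) (h1 : h ≤ 1) {η : ℂ}
    (hη : ‖η‖ = 1) {z : ℂ} (hz : ‖z‖ < 1) :
    ‖deriv (testFn κ α N h η) z‖ ≤ κ * N * h ^ ((N : ℝ) + 1 - α) *
      ‖1 - (starRingEnd ℂ) (((1 - h : ℝ) : ℂ) * η) * z‖ ^ (-((N : ℝ) + 1)) := by
  rw [(hasDerivAt_testFn κ α N h0 h1 hη hz).deriv, norm_mul, norm_mul, norm_mul, norm_inv, norm_pow,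
    Complex.norm_real, Real.norm_eq_abs, abs_of_nonneg (by positivity), Complex.norm_natCast,
    RCLike.norm_conj, norm_testPoint h1 hη, Real.rpow_neg (norm_nonneg _)]
  have : ((N : ℝ) + 1) = ((N + 1 : ℕ) : ℝ) := by push_cast; ring
  rw [this, Real.rpow_natCast]
  have h2 : (N : ℝ) * (1 - h) ≤ N * 1 := by
    gcongr
    linarith
  calc _ ≤ κ * h ^ ((N + 1 : ℕ) - α) * (N * 1 *
        (‖1 - (starRingEnd ℂ) (((1 - h : ℝ) : ℂ) * η) * z‖ ^ (N + 1))⁻¹) := by gcongr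
    _ = _ := by ring

lemma one_sub_norm_sq_rpow_mul_le {q t : ℝ} (ht : 0 < t) {a z : ℂ} (ha : ‖a‖ < 1) (hz : ‖z‖ < 1) :
    fWeight q t a z ≤ (1 - ‖z‖ ^ 2) ^ q := by
  obtain ⟨h1, h2⟩ := one_sub_norm_mobius_sq_mem ha hz
  refine mul_le_of_le_one_right (Real.rpow_nonneg (by nlinarith [norm_nonneg z]) _) ?_
  exact Real.rpow_le_one h1 h2 ht.le

/-- The test functions form a bounded family in `F(p, pα - 2, t)`. -/
lemma exists_testFn_fBound {α p t : ℝ} (hα : 1 < α) (hp : 1 < p) (ht : 0 < t) {N : ℕ}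
    (hN : α ≤ N) : ∃ C : ℝ, 0 < C ∧ ∀ {κ : ℝ} (_ : 0 ≤ κ) {h : ℝ} (_ : 0 < h) (_ : h ≤ 1) {η : ℂ}
    (_ : ‖η‖ = 1), FBound p (p * α - 2) t (κ * C) (testFn κ α N h η) := by
  have hp0 : 0 < p := by linarith
  have hk : 0 < (N : ℝ) + 1 - α := by linarith
  have hq : -1 < p * α - 2 := by nlinarith
  have hN0 : (0 : ℝ) < N := by linarith
  -- Chosen so that 2 + (pα-2) + c = p(N+1), the power of the denominator in |f'|^p. The resulting
  -- h^(-c) cancels the normalization h^c, while the Möbius factor is bounded by 1 uniformly in a.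
  set c := p * ((N : ℝ) + 1 - α) with hc
  obtain ⟨C₀, hC₀, hFR⟩ := lintegral_forelliRudin_le hq (c := c) (by positivity)
  refine ⟨1 + (N ^ p * C₀) ^ (1 / p), by positivity, fun {κ} hκ {h} h0 h1 {η} hη => ⟨?_, ?_, ?_⟩⟩
  · exact fun z hz => (hasDerivAt_testFn κ α N h0 h1 hη
      (mem_ball_zero_iff.1 hz)).differentiableAt.differentiableWithinAt
  · rw [norm_testFn hκ N h0]
    simp only [mul_zero, sub_zero, norm_one, one_pow, inv_one, mul_one]
    have h2 : h ^ ((N : ℝ) + 1 - α) ≤ 1 := Real.rpow_le_one h0.le h1 hk.le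
    have h3 : 0 ≤ ((N : ℝ) ^ p * C₀) ^ (1 / p) := by positivity
    gcongr
    linarith
  · rintro ⟨a, ha⟩
    rw [mem_ball_zero_iff] at ha
    set D : ℂ → ℝ := fun z => ‖1 - (starRingEnd ℂ) (((1 - h : ℝ) : ℂ) * η) * z‖ with hD
    calc _ ≤ ∫⁻ z in disc, ENNReal.ofReal ((κ * N) ^ p * h ^ c) *
          ENNReal.ofReal ((1 - ‖z‖ ^ 2) ^ (p * α - 2) * D z ^ (-(2 + (p * α - 2) + c))) := by
          refine setLIntegral_mono' measurableSet_ball fun z hz => ?_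
          rw [mem_ball_zero_iff] at hz
          have hD0 : 0 ≤ D z := norm_nonneg _
          have hw0 : 0 ≤ (1 - ‖z‖ ^ 2) ^ (p * α - 2) :=
            Real.rpow_nonneg (by nlinarith [norm_nonneg z]) _
          rw [enorm_rpow_eq_ofReal _ hp0.le, ← ENNReal.ofReal_mul (by positivity),
            ← ENNReal.ofReal_mul (by positivity)]
          apply ENNReal.ofReal_le_ofReal
          have h2 := Real.rpow_le_rpow (norm_nonneg _)
            (norm_deriv_testFn_le (α := α) hκ N h0 h1 hη hz) hp0.le
          rw [Real.mul_rpow (by positivity) (by positivity), Real.mul_rpow (by positivity)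
            (by positivity), ← Real.rpow_mul h0.le, ← Real.rpow_mul (norm_nonneg _)] at h2
          have h3 := one_sub_norm_sq_rpow_mul_le (q := p * α - 2) ht ha hz
          calc _ ≤ ((κ * N) ^ p * h ^ (((N : ℝ) + 1 - α) * p) * D z ^ (-((N : ℝ) + 1) * p)) *
                (1 - ‖z‖ ^ 2) ^ (p * α - 2) :=
                mul_le_mul h2 h3 (mul_nonneg hw0 (Real.rpow_nonneg
                  (one_sub_norm_mobius_sq_mem ha hz).1 _)) (by positivity)
            _ = _ := by
                rw [show ((N : ℝ) + 1 - α) * p = c by rw [hc]; ring,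
                  show -((N : ℝ) + 1) * p = -(2 + (p * α - 2) + c) by rw [hc]; ring]
                ring
      _ ≤ ENNReal.ofReal ((κ * N) ^ p * h ^ c) * ENNReal.ofReal (C₀ * h ^ (-c)) := by
          rw [lintegral_const_mul' _ _ ENNReal.ofReal_ne_top]
          gcongr
          exact hFR h0 h1 hη
      _ ≤ _ := by
          rw [← ENNReal.ofReal_mul (by positivity)]
          apply ENNReal.ofReal_le_ofReal
          have e : (κ * N) ^ p * h ^ c * (C₀ * h ^ (-c)) = κ ^ p * ((N ^ p * C₀) ^ (1 / p)) ^ p := by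
            rw [← Real.rpow_mul (by positivity) (1 / p), one_div_mul_cancel hp0.ne', Real.rpow_one,
              Real.mul_rpow hκ hN0.le]
            have : h ^ c * h ^ (-c) = 1 := by rw [← Real.rpow_add h0]; simp
            linear_combination κ ^ p * N ^ p * C₀ * this
          rw [e, Real.mul_rpow hκ (by positivity)]
          gcongr
          linarith

/-- On the tent |1 - conj a z| ≤ |ζ - z| + |I||z| ≤ 6|I|, where ζ is the midpoint of I. -/
lemma le_norm_testFn_of_mem_tent {κ α : ℝ} (hκ : 0 ≤ κ) (N : ℕ) {I : Arc} {z : ℂ}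
    (hz : z ∈ tent I) :
    κ * (6 ^ N)⁻¹ * I.length ^ (1 - α) ≤ ‖testFn κ α N I.length I.center z‖ := by
  have hI0 := I.length_pos
  have hI1 := I.length_le_one
  have hc := I.norm_center
  have hz1 := hz.2.1
  rw [norm_testFn hκ N hI0]
  have hpos := norm_one_sub_conj_mul_pos (a := ((1 - I.length : ℝ) : ℂ) * I.center) (z := z)
    (by rw [norm_testPoint hI1 hc]; linarith) hz1
  set D := ‖1 - (starRingEnd ℂ) (((1 - I.length : ℝ) : ℂ) * I.center) * z‖ with hD
  have hub : D ≤ 6 * I.length := by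
    have hcc : (starRingEnd ℂ) I.center * I.center = 1 := by
      rw [mul_comm, Complex.mul_conj, Complex.normSq_eq_norm_sq, hc]; simp
    have e : 1 - (starRingEnd ℂ) (((1 - I.length : ℝ) : ℂ) * I.center) * z =
        (starRingEnd ℂ) I.center * ((I.center - z) + (I.length : ℂ) * z) := by
      rw [map_mul, Complex.conj_ofReal]
      push_cast
      linear_combination -hcc
    rw [hD, e, norm_mul, RCLike.norm_conj, hc, one_mul]
    refine (norm_add_le _ _).trans ?_
    rw [norm_sub_rev, norm_mul, Complex.norm_real, Real.norm_eq_abs, abs_of_pos hI0]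
    have := norm_sub_center_le_of_mem_tent hz
    nlinarith
  have h2 : (D ^ N)⁻¹ ≥ ((6 * I.length) ^ N)⁻¹ := by gcongr
  calc κ * (6 ^ N)⁻¹ * I.length ^ (1 - α)
      = κ * I.length ^ ((N : ℝ) + 1 - α) * ((6 * I.length) ^ N)⁻¹ := by
        have : I.length ^ ((N : ℝ) + 1 - α) = I.length ^ (1 - α) * I.length ^ N := by
          rw [← Real.rpow_natCast, ← Real.rpow_add hI0]
          congr 1
          ring
        rw [this, mul_pow]
        field_simp
    _ ≤ _ := by gcongr

/-- For fixed z the denominators stay above (1-|z|)^N, while the normalizing power of |I| is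
positive because N ≥ α. -/
lemma tendsto_testFn {κ α : ℝ} (hκ : 0 ≤ κ) {N : ℕ} (hN : α ≤ N) {I : ℕ → Arc}
    (hI : Tendsto (fun n => (I n).length) atTop (𝓝 0)) {z : ℂ} (hz : z ∈ disc) :
    Tendsto (fun n => testFn κ α N (I n).length (I n).center z) atTop (𝓝 0) := by
  rw [mem_ball_zero_iff] at hz
  have hd : 0 < 1 - ‖z‖ := by linarith
  have hk : 0 < (N : ℝ) + 1 - α := by linarith
  have h1 := ((hI.rpow_const (p := (N : ℝ) + 1 - α) (Or.inr hk.le)).const_mul κ).mul_const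
    ((1 - ‖z‖) ^ N)⁻¹
  rw [Real.zero_rpow hk.ne', mul_zero, zero_mul] at h1
  refine squeeze_zero_norm (fun n => ?_) h1
  have hI0 := (I n).length_pos
  rw [norm_testFn hκ N hI0]
  have h2 := norm_sub_norm_le (1 : ℂ)
    ((starRingEnd ℂ) (((1 - (I n).length : ℝ) : ℂ) * (I n).center) * z)
  rw [norm_one, norm_mul, RCLike.norm_conj, norm_testPoint (I n).length_le_one (I n).norm_center]
    at h2
  have h3 : 1 - ‖z‖ ≤
      ‖1 - (starRingEnd ℂ) (((1 - (I n).length : ℝ) : ℂ) * (I n).center) * z‖ := by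
    refine le_trans ?_ h2
    nlinarith [norm_nonneg z]
  gcongr

/-! ### Necessity: compactness gives vanishing Carleson measures. -/

lemma lintegral_tent_le_tENorm {p s : ℝ} (hp : 0 < p) (μ : Measure ℂ) (f : ℂ → ℂ) (I : Arc) :
    (∫⁻ z in tent I, ‖f z‖ₑ ^ p ∂μ) / ENNReal.ofReal (I.length ^ s) ≤ tENorm p s μ f ^ p := by
  have h := ENNReal.rpow_le_rpow (le_iSup (fun I : Arc =>
    ((∫⁻ z in tent I, ‖f z‖ₑ ^ p ∂μ) / ENNReal.ofReal (I.length ^ s)) ^ (1 / p)) I) hp.le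
  rwa [← ENNReal.rpow_mul, one_div_mul_cancel hp.ne', ENNReal.rpow_one] at h

/-- If holomorphic functions converge to `g` in the tent space and to zero pointwise, then they
converge to zero in the tent space. -/
lemma tendsto_tENorm_zero_of_tendsto {p s : ℝ} (hp : 1 ≤ p) {μ : Measure ℂ} {F : ℕ → ℂ → ℂ}
    {g : ℂ → ℂ} (hF : ∀ n, DifferentiableOn ℂ (F n) disc) (hg : DifferentiableOn ℂ g disc)
    (h : Tendsto (fun n => tENorm p s μ (F n - g)) atTop (𝓝 0))
    (h0 : ∀ z ∈ disc, Tendsto (fun n => F n z) atTop (𝓝 0)) :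
    Tendsto (fun n => tENorm p s μ (F n)) atTop (𝓝 0) := by
  have hp0 : 0 < p := by linarith
  -- The tent norm is only a seminorm, so g need not vanish. Fatou's lemma along F n - g, which
  -- tends to -g pointwise, shows that its seminorm is zero.
  have hg0 : tENorm p s μ g = 0 := by
    rw [← nonpos_iff_eq_zero]
    have hz : (0 : ℝ≥0∞) ^ (1 / p) = 0 := ENNReal.zero_rpow_of_pos (by positivity)
    rw [← hz]
    refine tENorm_le_of_forall hp0 fun I => ?_
    rw [nonpos_iff_eq_zero, ENNReal.div_eq_zero_iff]
    left
    have hmeas : ∀ n, AEMeasurable (fun z => ‖(F n - g) z‖ₑ ^ p) (μ.restrict (tent I)) := fun n =>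
      (((((hF n).sub hg).continuousOn.aemeasurable measurableSet_ball).mono_measure
        (Measure.restrict_mono (tent_subset I) le_rfl)).enorm).pow_const p
    have hlim : Tendsto (fun n => ∫⁻ z in tent I, ‖(F n - g) z‖ₑ ^ p ∂μ) atTop (𝓝 0) := by
      have h1 := ((ENNReal.continuous_rpow_const (y := p)).tendsto 0).comp h
      rw [ENNReal.zero_rpow_of_pos hp0] at h1
      have h2 := ENNReal.Tendsto.mul_const (b := ENNReal.ofReal (I.length ^ s)) h1
        (Or.inr ENNReal.ofReal_ne_top)
      rw [zero_mul] at h2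
      refine tendsto_of_tendsto_of_tendsto_of_le_of_le tendsto_const_nhds h2 (fun _ => zero_le)
        fun n => ?_
      have h3 := lintegral_tent_le_tENorm (s := s) hp0 μ (F n - g) I
      rwa [ENNReal.div_le_iff (ofReal_length_rpow_ne_zero I s) ENNReal.ofReal_ne_top] at h3
    rw [← nonpos_iff_eq_zero]
    calc ∫⁻ z in tent I, ‖g z‖ₑ ^ p ∂μ
        = ∫⁻ z in tent I, liminf (fun n => ‖(F n - g) z‖ₑ ^ p) atTop ∂μ := by
          refine setLIntegral_congr_fun (measurableSet_tent I) fun z hz => ?_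
          refine (Tendsto.liminf_eq ?_).symm
          have h1 := ((h0 z (tent_subset I hz)).sub_const (g z)).enorm
          rw [zero_sub, enorm_neg] at h1
          exact ((ENNReal.continuous_rpow_const (y := p)).tendsto _).comp h1
      _ ≤ liminf (fun n => ∫⁻ z in tent I, ‖(F n - g) z‖ₑ ^ p ∂μ) atTop :=
          lintegral_liminf_le' hmeas
      _ = 0 := hlim.liminf_eq
  refine tendsto_of_tendsto_of_tendsto_of_le_of_le tendsto_const_nhds h (fun _ => zero_le)
    fun n => ?_
  have h1 := tENorm_add_le (s := s) (μ := μ) hp ((hF n).sub hg) hg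
  rwa [sub_add_cancel, hg0, add_zero] at h1

/-- The pointwise lower bound is raised to the power p and integrated over S(I); the factor
|I|^(p(1-α)) supplies the exponent p(α-1) beyond s. -/
lemma measure_tent_div_le {α p s κ : ℝ} (hp : 1 < p) (hκ : 0 < κ) (N : ℕ) (μ : Measure ℂ)
    (I : Arc) :
    μ (tent I) / ENNReal.ofReal (I.length ^ (s + p * (α - 1))) ≤
      ENNReal.ofReal (((κ * (6 ^ N)⁻¹) ^ p)⁻¹) *
        tENorm p s μ (testFn κ α N I.length I.center) ^ p := by
  have hp0 : 0 < p := by linarith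
  have hI0 := I.length_pos
  refine le_trans ?_ (mul_le_mul' le_rfl (lintegral_tent_le_tENorm hp0 μ _ I))
  set b := (κ * (6 ^ N)⁻¹) ^ p with hb
  have hb0 : 0 < b := by positivity
  have h1 : ENNReal.ofReal (b * I.length ^ (p * (1 - α))) * μ (tent I) ≤
      ∫⁻ z in tent I, ‖testFn κ α N I.length I.center z‖ₑ ^ p ∂μ := by
    rw [← setLIntegral_const]
    refine setLIntegral_mono' (measurableSet_tent I) fun z hz => ?_
    rw [enorm_rpow_eq_ofReal _ hp0.le]
    apply ENNReal.ofReal_le_ofReal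
    refine le_trans (le_of_eq ?_) (Real.rpow_le_rpow (by positivity)
      (le_norm_testFn_of_mem_tent (α := α) hκ.le N hz) hp0.le)
    rw [Real.mul_rpow (by positivity) (by positivity), ← Real.rpow_mul hI0.le, mul_comm p]
  rw [ENNReal.div_le_iff (ofReal_length_rpow_ne_zero I _) ENNReal.ofReal_ne_top]
  calc μ (tent I) = ENNReal.ofReal (b⁻¹ * (I.length ^ s)⁻¹ * I.length ^ (s + p * (α - 1))) *
        (ENNReal.ofReal (b * I.length ^ (p * (1 - α))) * μ (tent I)) := by
        rw [← mul_assoc, ← ENNReal.ofReal_mul (by positivity)]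
        have e : b⁻¹ * (I.length ^ s)⁻¹ * I.length ^ (s + p * (α - 1)) *
            (b * I.length ^ (p * (1 - α))) = 1 := by
          have e2 : I.length ^ (s + p * (α - 1)) * I.length ^ (p * (1 - α)) = I.length ^ s := by
            rw [← Real.rpow_add hI0]
            congr 1
            ring
          have e3 : I.length ^ s ≠ 0 := by positivity
          calc _ = b⁻¹ * b * ((I.length ^ s)⁻¹ *
              (I.length ^ (s + p * (α - 1)) * I.length ^ (p * (1 - α)))) := by ring
            _ = 1 := by rw [e2, inv_mul_cancel₀ e3, inv_mul_cancel₀ hb0.ne', one_mul]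
        rw [e, ENNReal.ofReal_one, one_mul]
    _ ≤ ENNReal.ofReal (b⁻¹ * (I.length ^ s)⁻¹ * I.length ^ (s + p * (α - 1))) *
        ∫⁻ z in tent I, ‖testFn κ α N I.length I.center z‖ₑ ^ p ∂μ := by gcongr
    _ = _ := by
        rw [ENNReal.ofReal_mul (by positivity), ENNReal.ofReal_mul (by positivity),
          ENNReal.ofReal_inv_of_pos (by positivity : 0 < I.length ^ s), ENNReal.div_eq_inv_mul]
        ring

lemma isVanishingCarleson_of_idIsCompact {α p s t : ℝ} (hα : 1 < α) (hp : 1 < p) (ht : 0 < t)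
    {μ : Measure ℂ} (h : IdIsCompact p (p * α - 2) t s μ hp.le) :
    IsVanishingCarleson (s + p * (α - 1)) μ := by
  have hp0 : 0 < p := by linarith
  obtain ⟨hle, K, hK, hKnhds⟩ := h
  obtain ⟨δ, hδ, hball⟩ := Metric.mem_nhds_iff.1 hKnhds
  obtain ⟨N, hN⟩ := exists_nat_ge α
  obtain ⟨C, hC, htest⟩ := exists_testFn_fBound hα hp ht hN
  -- The F-norms are then at most 2κC = δ/2, which places the images of the test functions in the
  -- compact set K.
  set κ := δ / (4 * C) with hκ
  have hκ0 : 0 < κ := by positivity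
  -- It suffices that every sequence of arcs with lengths tending to zero has a subsequence along
  -- which the quotient tends to zero, which is what compactness of K provides.
  refine tendsto_of_subseq_tendsto fun I hI => ?_
  have hlen : Tendsto (fun n => (I n).length) atTop (𝓝 0) := tendsto_comap_iff.1 hI
  have hB : ∀ n, FBound p (p * α - 2) t (κ * C) (testFn κ α N (I n).length (I n).center) := fun n =>
    htest hκ0.le (I n).length_pos (I n).length_le_one (I n).norm_center
  have hlt : ∀ n, fENorm p (p * α - 2) t (testFn κ α N (I n).length (I n).center) ≤
      ENNReal.ofReal (δ / 2) := fun n => by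
    refine ((hB n).fENorm_le hp0).trans (le_of_eq ?_)
    congr 1
    rw [hκ]
    field_simp
    norm_num
  set G : ℕ → FSpace p (p * α - 2) t hp.le := fun n =>
    ⟨testFn κ α N (I n).length (I n).center, (hB n).diff, (hlt n).trans_lt ENNReal.ofReal_lt_top⟩
    with hG
  have hGK : ∀ n, idMap hle (G n) ∈ K := fun n => by
    apply hball
    rw [mem_ball_zero_iff]
    change (fENorm p (p * α - 2) t (testFn κ α N (I n).length (I n).center)).toReal < δ
    have := ENNReal.toReal_mono ENNReal.ofReal_ne_top (hlt n)
    rw [ENNReal.toReal_ofReal (by positivity)] at this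
    linarith
  obtain ⟨g, -, φ, hφ, hlim⟩ := hK.tendsto_subseq hGK
  have hlim2 : Tendsto (fun n => tENorm p s μ
      (testFn κ α N (I (φ n)).length (I (φ n)).center - g.1)) atTop (𝓝 0) := by
    rw [tendsto_iff_norm_sub_tendsto_zero] at hlim
    have h1 : Tendsto (fun n => (tENorm p s μ
      (testFn κ α N (I (φ n)).length (I (φ n)).center - g.1)).toReal) atTop (𝓝 0) := hlim
    have h2 := ENNReal.tendsto_ofReal h1
    rw [ENNReal.ofReal_zero] at h2
    refine h2.congr fun n => ENNReal.ofReal_toReal ?_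
    exact ((tSubmodule p s μ hp.le).sub_mem (idMap hle (G (φ n))).2 g.2).2.ne
  have hlen2 : Tendsto (fun n => (I (φ n)).length) atTop (𝓝 0) := hlen.comp hφ.tendsto_atTop
  have h3 := tendsto_tENorm_zero_of_tendsto hp.le (fun n => (hB (φ n)).diff) g.2.1 hlim2
    (fun z hz => tendsto_testFn hκ0.le hN (I := fun n => I (φ n)) hlen2 hz)
  refine ⟨φ, ?_⟩
  have h4 := ((ENNReal.continuous_rpow_const (y := p)).tendsto 0).comp h3
  rw [ENNReal.zero_rpow_of_pos hp0] at h4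
  have h5 := ENNReal.Tendsto.const_mul (a := ENNReal.ofReal (((κ * (6 ^ N)⁻¹) ^ p)⁻¹)) h4
    (Or.inr ENNReal.ofReal_ne_top)
  rw [mul_zero] at h5
  exact tendsto_of_tendsto_of_tendsto_of_le_of_le tendsto_const_nhds h5 (fun _ => zero_le)
    fun n => measure_tent_div_le hp hκ0 N μ (I (φ n))

end NearEndpoint

/-- The measure `μ` on the unit disc is given as a measure on `ℂ`, of which only the restriction to
the disc matters; it is finite on compact subsets of the disc. -/
theorem mainTheorem5 (α p s t : ℝ) (hα : 1 < α) (hp : 1 < p) (ht : 0 < t) (hts : t < s)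
    (hs : s ≤ 1) (μ : MeasureTheory.Measure ℂ)
    (hμ : ∀ K ⊆ NearEndpoint.disc, IsCompact K → μ K < ⊤) :
    NearEndpoint.IdIsCompact p (p * α - 2) t s μ hp.le ↔
      NearEndpoint.IsVanishingCarleson (s + p * (α - 1)) μ := by
  exact ⟨NearEndpoint.isVanishingCarleson_of_idIsCompact hα hp ht,
    NearEndpoint.idIsCompact_of_isVanishingCarleson hα hp ht hts hμ⟩
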